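/- **Theorem 3.5.** For $\ell\ge 0$ let $f_\ell(r)=(1-r^2)_+^\ell$ (for $\ell=0$: the indicator function of $[-1,1]$), let $f_\ell*f_\ell$ be the convolution on $\mathbb R$, and let $\mathscr D\varphi(r)=-\varphi'(r)/r$, with the value at $r=0$ defined as the limit for $r\to0+$. For $k\in\mathbb N=\{0,1,2,\dots\}$ and real $\ell\ge k$ the Wu function is $\varphi_{\ell,k}=\mathscr D^k(f_\ell*f_\ell)$ on $[0,\infty)$. Put $d=2k+1$ and $\Phi(x)=\varphi_{\ell,k}(\|x\|_2)$ for $x\in\mathbb R^d$. The native space $\mathcal N_\Phi(\mathbb R^d)$, that is, the real Hilbert space of real functions on $\mathbb R^d$ with reproducing kernel $(x,y)\mapsto\Phi(x-y)$, exists. For every real $s$ with $k+\tfrac12<s\le\ell+1$ it is a linear subspace of the Sobolev space $$H^s(\mathbb R^d)=\{f\in L^2(\mathbb R^d):\ \hat f\,(1+\|\cdot\|_2^2)^{s/2}\in L^2(\mathbb R^d)\},\qquad \|f\|_{H^s}^2=(2\pi)^{-d/2}\int_{\mathbb R^d}|\hat f(\omega)|^2(1+\|\omega\|_2^2)^s\,d\omega,$$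 where $\hat f(\omega)=(2\pi)^{-d/2}\int f(x)e^{-i\langle\omega,x\rangle}dx$ (extended to $L^2$), and the inclusion is continuous: every $f\in\mathcal N_\Phi(\mathbb R^d)$ belongs to $H^s(\mathbb R^d)$, distinct elements of $\mathcal N_\Phi(\mathbb R^d)$ define distinct elements of $L^2(\mathbb R^d)$, and there is a constant $C$, depending only on $k,\ell,s$, with $\|f\|_{H^s(\mathbb R^d)}\le C\,\|f\|_{\mathcal N_\Phi(\mathbb R^d)}$ for all $f\in\mathcal N_\Phi(\mathbb R^d)$. -/

import Mathlib

open MeasureTheory Filter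
open scoped Topology FourierTransform

noncomputable section

namespace WuFunctions

/-- The function `f_ℓ(r) = (1 - r²)_+^ℓ`, as an even function on the real line. For `ℓ = 0` it is
the indicator function of `[-1, 1]`. -/
def truncPow (ℓ r : ℝ) : ℝ := if r ^ 2 ≤ 1 then (1 - r ^ 2) ^ ℓ else 0

/-- The convolution `f_ℓ * f_ℓ` on the real line. -/
def selfConv (ℓ r : ℝ) : ℝ := ∫ t : ℝ, truncPow ℓ t * truncPow ℓ (r - t)

/-- The operator `𝒟φ(r) = -φ'(r) / r` on functions of `r ≥ 0`; its value at `r = 0` is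
the limit for `r → 0+`. Only the values at `r ≥ 0` are ever used, and those at `r > 0` depend on
`φ` restricted to `(0, ∞)` only. -/
def dimWalk (φ : ℝ → ℝ) (r : ℝ) : ℝ :=
  if r = 0 then limUnder (𝓝[>] (0 : ℝ)) (fun t => -(deriv φ t) / t) else -(deriv φ r) / r

/-- The Wu function `φ_{ℓ,k} = 𝒟^k (f_ℓ * f_ℓ)`. -/
def wu (ℓ : ℝ) (k : ℕ) : ℝ → ℝ := dimWalk^[k] (selfConv ℓ)

/-- `d`-dimensional Euclidean space. -/
abbrev E (d : ℕ) : Type := EuclideanSpace ℝ (Fin d)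

/-- The radial function `Φ(x) = φ_{ℓ,k}(‖x‖₂)` on `ℝ^{2k+1}`. -/
def wuRadial (ℓ : ℝ) (k : ℕ) (x : E (2 * k + 1)) : ℝ := wu ℓ k ‖x‖

/-- `K` is a reproducing kernel of the real Hilbert space `H` of real functions on `X`:
`K(·, y) ∈ H` and `f(y) = ⟨f, K(·, y)⟩` for all `f ∈ H` and all `y`. -/
def IsReproducingKernel {X : Type*} (H : Type*) [NormedAddCommGroup H] [InnerProductSpace ℝ H]
    [RKHS ℝ H X ℝ] (K : X → X → ℝ) : Prop :=
  ∀ y : X, ∃ g : H, (∀ x : X, g x = K x y) ∧ ∀ f : H, f y = inner ℝ f g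

/-- The real Hilbert space `H` of real functions on `E d` is the native space of the function `Φ`:
the kernel `(x, y) ↦ Φ(x - y)` is the reproducing kernel of `H`. -/
def IsNativeSpace {d : ℕ} (H : Type*) [NormedAddCommGroup H] [InnerProductSpace ℝ H]
    [CompleteSpace H] [RKHS ℝ H (E d) ℝ] (Φ : E d → ℝ) : Prop :=
  IsReproducingKernel H (fun x y : E d => Φ (x - y))

/-- The Fourier transform on `L²(ℝ^d)` in the unitary normalization
`f̂(ω) = (2π)^{-d/2} ∫ f(x) exp(-i⟨ω, x⟩) dx`, obtained by rescaling Mathlib's transform, which has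
`exp(-2πi⟨ω, x⟩)` and no prefactor. -/
def fourierL2 {d : ℕ} (f : Lp ℂ 2 (volume : Measure (E d))) (ω : E d) : ℂ :=
  (((2 * Real.pi) ^ (-(d : ℝ) / 2) : ℝ) : ℂ) *
    (𝓕 f : Lp ℂ 2 (volume : Measure (E d))) ((2 * Real.pi)⁻¹ • ω)

/-- The Sobolev space `H^s(ℝ^d)` of all `f ∈ L²` with `f̂ (1 + ‖·‖²)^{s/2} ∈ L²`. -/
def sobolevSpace (d : ℕ) (s : ℝ) : Set (Lp ℂ 2 (volume : Measure (E d))) :=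
  {f | MemLp (fun ω : E d => fourierL2 f ω * (((1 + ‖ω‖ ^ 2) ^ (s / 2) : ℝ) : ℂ)) 2 volume}

/-- The inner product `(2π)^{-d/2} ∫ f̂(ω) conj(ĝ(ω)) (1 + ‖ω‖²)^s dω` of `H^s(ℝ^d)`. -/
def sobolevInner {d : ℕ} (s : ℝ) (f g : Lp ℂ 2 (volume : Measure (E d))) : ℂ :=
  (((2 * Real.pi) ^ (-(d : ℝ) / 2) : ℝ) : ℂ) *
    ∫ ω : E d, fourierL2 f ω * (starRingEnd ℂ) (fourierL2 g ω) *
      (((1 + ‖ω‖ ^ 2) ^ s : ℝ) : ℂ)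

/-- The norm of `H^s(ℝ^d)`. -/
def sobolevNorm {d : ℕ} (s : ℝ) (f : Lp ℂ 2 (volume : Measure (E d))) : ℝ :=
  Real.sqrt (sobolevInner s f f).re

end WuFunctions

end

open MeasureTheory Filter
open scoped Topology FourierTransform

noncomputable section

namespace WuFunctions

/-! The function `wuRadial ℓ k` has a nonnegative spectral density, a multiple of `powCos ℓ ‖ω‖ ^
2`, and the decay of this density decides which Sobolev spaces contain the native space.

The density is found on the line, where the transform of `f_ℓ * f_ℓ` is the square of that of `f_ℓ`
(`selfConv_eq_integral`). The operator 𝒟 keeps the weight of a radial Fourier integral and raises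
the dimension by two (`dimWalk_radialIntegral`), so after `k` steps the same weight stands in
dimension `2k+1`; `exists_integral_radial_mul_cos` identifies the result with a genuine Fourier
integral there. The singularity of `(1 - t²)^ℓ` at `t = 1` gives `powCos ℓ ω = O(ω^{-ℓ-1})`
(`exists_abs_powCos_le`), hence a density of order `(1 + ‖ω‖²)^{-(ℓ+1)}`, integrable because `2k+1 <
2ℓ+2`.

The rest holds for any even, continuous, integrable density `p ≥ 0` with such decay. The features
`√p · exp(-2πi⟨·, y⟩)` in `L²` have inner products `Φ(x - y)`, so a native space exists, and every
native space embeds isometrically into `L²` by some `W` (`exists_isometry_of_isReproducingKernel`).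
The reproducing formula then reads `f = 𝓕⁻(√p · W f)` pointwise. Since `p` times the Sobolev weight
of order `s ≤ ℓ + 1` is bounded, the Sobolev norm of `f` is at most a constant times `‖W f‖ = ‖f‖`.
-/

/-! ### Decay of the Fourier transform of the truncated power -/

/-- The cosine integral of the weight `(1 - t²)^ℓ` over `[0, 1]`. -/
def powCos (ℓ ω : ℝ) : ℝ := ∫ t in (0 : ℝ)..1, (1 - t ^ 2) ^ ℓ * Real.cos (ω * t)

/-- The sine integral of the weight `t (1 - t²)^ℓ` over `[0, 1]`. -/
def powSin (ℓ ω : ℝ) : ℝ := ∫ t in (0 : ℝ)..1, t * (1 - t ^ 2) ^ ℓ * Real.sin (ω * t)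

lemma intervalIntegrable_one_sub_rpow {ℓ a b : ℝ} (hℓ : -1 < ℓ) :
    IntervalIntegrable (fun t : ℝ => (1 - t) ^ ℓ) volume a b := by
  have h := (intervalIntegral.intervalIntegrable_rpow' (a := 1 - a) (b := 1 - b) hℓ).comp_sub_left 1
  simpa using h

lemma intervalIntegrable_one_sub_sq_rpow {ℓ : ℝ} (hℓ : -1 < ℓ) :
    IntervalIntegrable (fun t : ℝ => (1 - t ^ 2) ^ ℓ) volume 0 1 := by
  have h : IntervalIntegrable (fun t : ℝ => (1 - t) ^ ℓ * (1 + t) ^ ℓ) volume 0 1 := by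
    refine (intervalIntegrable_one_sub_rpow hℓ).mul_continuousOn ?_
    intro t ht
    rw [Set.uIcc_of_le zero_le_one] at ht
    refine ContinuousAt.continuousWithinAt ?_
    exact (by fun_prop : ContinuousAt (fun t : ℝ => 1 + t) t).rpow_const
      (Or.inl (by have := ht.1; positivity))
  refine h.congr fun t ht => ?_
  rw [Set.uIoc_of_le zero_le_one] at ht
  rw [← Real.mul_rpow (by linarith [ht.2]) (by linarith [ht.1])]
  ring_nf

lemma intervalIntegrable_powCos {ℓ : ℝ} (hℓ : -1 < ℓ) (ω : ℝ) :
    IntervalIntegrable (fun t : ℝ => (1 - t ^ 2) ^ ℓ * Real.cos (ω * t)) volume 0 1 :=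
  (intervalIntegrable_one_sub_sq_rpow hℓ).mul_continuousOn (by fun_prop)

lemma intervalIntegrable_powSin {ℓ : ℝ} (hℓ : -1 < ℓ) (ω : ℝ) :
    IntervalIntegrable (fun t : ℝ => t * (1 - t ^ 2) ^ ℓ * Real.sin (ω * t)) volume 0 1 :=
  ((intervalIntegrable_one_sub_sq_rpow hℓ).continuousOn_mul (g := fun t : ℝ => t)
    (by fun_prop)).mul_continuousOn (by fun_prop)

lemma hasDerivAt_one_sub_sq_rpow (ℓ : ℝ) {t : ℝ} (h0 : 0 ≤ t) (h1 : t < 1) :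
    HasDerivAt (fun t : ℝ => (1 - t ^ 2) ^ ℓ) (-(2 * ℓ * (t * (1 - t ^ 2) ^ (ℓ - 1)))) t := by
  have h : HasDerivAt (fun t : ℝ => 1 - t ^ 2) (-(2 * t)) t := by
    simpa using ((hasDerivAt_id t).pow 2).const_sub 1
  have := h.rpow_const (p := ℓ) (Or.inl (by nlinarith))
  convert! this using 1
  ring

/-- Integrate the derivative of `(1 - t²)^ℓ sin(ωt)`, which vanishes at both ends. Together with
`mul_powSin` this trades one unit of `ℓ` for one power of `ω`. -/
lemma mul_powCos {ℓ : ℝ} (hℓ : 0 < ℓ) (ω : ℝ) :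
    ω * powCos ℓ ω = 2 * ℓ * powSin (ℓ - 1) ω := by
  have hi : IntervalIntegrable (fun t : ℝ => ω * ((1 - t ^ 2) ^ ℓ * Real.cos (ω * t)) -
      2 * ℓ * (t * (1 - t ^ 2) ^ (ℓ - 1) * Real.sin (ω * t))) volume 0 1 :=
    ((intervalIntegrable_powCos (by linarith) ω).const_mul ω).sub
      ((intervalIntegrable_powSin (by linarith) ω).const_mul (2 * ℓ))
  have key := intervalIntegral.integral_eq_sub_of_hasDerivAt_of_le (a := 0) (b := 1)
    (f := fun t : ℝ => (1 - t ^ 2) ^ ℓ * Real.sin (ω * t)) zero_le_one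
    (by
      refine ContinuousOn.mul (ContinuousOn.rpow_const (by fun_prop) fun _ _ => Or.inr hℓ.le)
        (by fun_prop)) (f' := _) (fun t ht => by
      have h1 := hasDerivAt_one_sub_sq_rpow ℓ ht.1.le ht.2
      have h2 : HasDerivAt (fun t : ℝ => Real.sin (ω * t)) (Real.cos (ω * t) * ω) t := by
        simpa using ((hasDerivAt_id t).const_mul ω).sin
      have h3 : ω * ((1 - t ^ 2) ^ ℓ * Real.cos (ω * t)) -
          2 * ℓ * (t * (1 - t ^ 2) ^ (ℓ - 1) * Real.sin (ω * t)) =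
          -(2 * ℓ * (t * (1 - t ^ 2) ^ (ℓ - 1))) * Real.sin (ω * t) +
            (1 - t ^ 2) ^ ℓ * (Real.cos (ω * t) * ω) := by ring
      have := h1.mul h2
      rw [← h3] at this
      exact this) hi
  rw [intervalIntegral.integral_sub ((intervalIntegrable_powCos (by linarith) ω).const_mul ω)
    ((intervalIntegrable_powSin (by linarith) ω).const_mul (2 * ℓ)),
    intervalIntegral.integral_const_mul, intervalIntegral.integral_const_mul] at key
  simp [Real.zero_rpow hℓ.ne'] at key
  unfold powCos powSin
  linarith

/-- Integrate the derivative of `t (1 - t²)^ℓ cos(ωt)`. Writing `t² = 1 - (1 - t²)` in the term with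
exponent `ℓ - 1` leaves only integrals of the form `powCos`. -/
lemma mul_powSin {ℓ : ℝ} (hℓ : 0 < ℓ) (ω : ℝ) :
    ω * powSin ℓ ω = (1 + 2 * ℓ) * powCos ℓ ω - 2 * ℓ * powCos (ℓ - 1) ω := by
  have i1 := (intervalIntegrable_powCos (ℓ := ℓ) (by linarith) ω).const_mul (1 + 2 * ℓ)
  have i2 := (intervalIntegrable_powCos (ℓ := ℓ - 1) (by linarith) ω).const_mul (2 * ℓ)
  have i3 := (intervalIntegrable_powSin (ℓ := ℓ) (by linarith) ω).const_mul ω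
  have key := intervalIntegral.integral_eq_sub_of_hasDerivAt_of_le (a := 0) (b := 1)
    (f := fun t : ℝ => t * (1 - t ^ 2) ^ ℓ * Real.cos (ω * t)) zero_le_one
    (by
      refine ContinuousOn.mul (ContinuousOn.mul (by fun_prop)
        (ContinuousOn.rpow_const (by fun_prop) fun _ _ => Or.inr hℓ.le))
        (by fun_prop)) (f' := _) (fun t ht => by
      have h1 := (hasDerivAt_id t).mul (hasDerivAt_one_sub_sq_rpow ℓ ht.1.le ht.2)
      have h2 : HasDerivAt (fun t : ℝ => Real.cos (ω * t)) (-Real.sin (ω * t) * ω) t := by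
        simpa using ((hasDerivAt_id t).const_mul ω).cos
      have h4 : (1 - t ^ 2) ^ ℓ = (1 - t ^ 2) * (1 - t ^ 2) ^ (ℓ - 1) := by
        rw [Real.rpow_sub_one (by nlinarith [ht.1, ht.2])]
        field_simp [show 1 - t ^ 2 ≠ 0 by nlinarith [ht.1, ht.2]]
      have h3 : (1 + 2 * ℓ) * ((1 - t ^ 2) ^ ℓ * Real.cos (ω * t)) -
          2 * ℓ * ((1 - t ^ 2) ^ (ℓ - 1) * Real.cos (ω * t)) -
          ω * (t * (1 - t ^ 2) ^ ℓ * Real.sin (ω * t)) =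
          (1 * (1 - t ^ 2) ^ ℓ + t * -(2 * ℓ * (t * (1 - t ^ 2) ^ (ℓ - 1)))) * Real.cos (ω * t) +
            t * (1 - t ^ 2) ^ ℓ * (-Real.sin (ω * t) * ω) := by
        rw [h4]; ring
      have := h1.mul h2
      simp only [id_eq] at this
      erw [← h3] at this
      exact this) ((i1.sub i2).sub i3)
  rw [intervalIntegral.integral_sub (i1.sub i2) i3, intervalIntegral.integral_sub i1 i2,
    intervalIntegral.integral_const_mul, intervalIntegral.integral_const_mul,
    intervalIntegral.integral_const_mul] at key
  simp [Real.zero_rpow hℓ.ne'] at key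
  unfold powCos powSin
  linarith

/-- The oscillatory integral of a nonnegative increasing weight, by integration by parts. -/
lemma abs_integral_mul_le_of_deriv_nonneg {w w' τ T : ℝ → ℝ} {b ω : ℝ} (hb : 0 ≤ b) (hω : 0 < ω)
    (hw : ∀ t ∈ Set.Icc 0 b, HasDerivAt w (w' t) t) (hw0 : 0 ≤ w 0)
    (hw' : ∀ t ∈ Set.Icc 0 b, 0 ≤ w' t) (hcw : ContinuousOn w' (Set.Icc 0 b))
    (hT : ∀ t, HasDerivAt T (ω * τ t) t) (hT1 : ∀ t, |T t| ≤ 1) (hτ : Continuous τ) :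
    |∫ t in (0 : ℝ)..b, w t * τ t| ≤ 2 * w b / ω := by
  have hu : Set.uIcc 0 b = Set.Icc 0 b := Set.uIcc_of_le hb
  have hTc : Continuous T := continuous_iff_continuousAt.2 fun t => (hT t).continuousAt
  have iw' : IntervalIntegrable w' volume 0 b := (hu ▸ hcw).intervalIntegrable
  have iωτ : IntervalIntegrable (fun t => ω * τ t) volume 0 b :=
    (by fun_prop : Continuous fun t => ω * τ t).intervalIntegrable _ _
  have parts := intervalIntegral.integral_mul_deriv_eq_deriv_mul (u := w) (v := T)
    (fun t ht => hw t (hu ▸ ht)) (fun t _ => hT t) iw' iωτ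
  have hint : ∫ t in (0 : ℝ)..b, w' t = w b - w 0 :=
    intervalIntegral.integral_eq_sub_of_hasDerivAt (fun t ht => hw t (hu ▸ ht)) iw'
  -- As `w` increases, its total variation is `w b - w 0`; with the boundary terms `w b` and `w 0`
  -- the bound adds up to `2 * w b`.
  have hrest : |∫ t in (0 : ℝ)..b, w' t * T t| ≤ w b - w 0 := by
    rw [← hint, ← Real.norm_eq_abs]
    refine intervalIntegral.norm_integral_le_of_norm_le hb ?_ iw'
    refine ae_of_all _ fun t ht => ?_
    rw [norm_mul, Real.norm_of_nonneg (hw' t ⟨ht.1.le, ht.2⟩), Real.norm_eq_abs]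
    exact mul_le_of_le_one_right (hw' t ⟨ht.1.le, ht.2⟩) (hT1 t)
  have hmono : w 0 ≤ w b := by
    have := abs_nonneg (∫ t in (0 : ℝ)..b, w' t * T t)
    linarith
  have e : ω * ∫ t in (0 : ℝ)..b, w t * τ t =
      w b * T b - w 0 * T 0 - ∫ t in (0 : ℝ)..b, w' t * T t := by
    rw [← parts, ← intervalIntegral.integral_const_mul]
    congr 1; ext t; ring
  have h1 : |w b * T b| ≤ w b := by
    rw [abs_mul, abs_of_nonneg (hw0.trans hmono)]
    exact mul_le_of_le_one_right (hw0.trans hmono) (hT1 b)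
  have h2 : |w 0 * T 0| ≤ w 0 := by
    rw [abs_mul, abs_of_nonneg hw0]
    exact mul_le_of_le_one_right hw0 (hT1 0)
  have hmul (x : ℝ) : |x| * ω = |ω * x| := by rw [abs_mul, abs_of_pos hω, mul_comm]
  rw [le_div_iff₀ hω, hmul, e]
  rw [abs_le] at *
  constructor <;> linarith [h1.1, h1.2, h2.1, h2.2, hrest.1, hrest.2]

/-- A weight on `[0, 1)` that increases and is at most `(1 - t)^ℓ` has an oscillatory integral of
order `ω^{-ℓ-1}`. -/
lemma abs_integral_mul_le_of_le_rpow {w w' τ T : ℝ → ℝ} {ℓ ω : ℝ} (hℓ : -1 < ℓ) (hω : 1 ≤ ω)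
    (hw : ∀ t ∈ Set.Ico (0 : ℝ) 1, HasDerivAt w (w' t) t) (hw0 : ∀ t ∈ Set.Ico (0 : ℝ) 1, 0 ≤ w t)
    (hw' : ∀ t ∈ Set.Ico (0 : ℝ) 1, 0 ≤ w' t) (hcw : ContinuousOn w' (Set.Ico (0 : ℝ) 1))
    (hle : ∀ t ∈ Set.Ico (0 : ℝ) 1, w t ≤ (1 - t) ^ ℓ)
    (hi : IntervalIntegrable (fun t => w t * τ t) volume 0 1)
    (hT : ∀ t, HasDerivAt T (ω * τ t) t) (hT1 : ∀ t, |T t| ≤ 1) (hτ1 : ∀ t, |τ t| ≤ 1)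
    (hτ : Continuous τ) :
    |∫ t in (0 : ℝ)..1, w t * τ t| ≤ (2 + 1 / (ℓ + 1)) * ω ^ (-ℓ - 1) := by
  have hω0 : 0 < ω := by linarith
  -- At distance `ω⁻¹` from the singularity the two estimates balance: integration by parts on `[0,
  -- b]` and the trivial bound on `[b, 1]` both give `ω^{-ℓ-1}`.
  set b : ℝ := 1 - ω⁻¹ with hb
  have hinv : 0 < ω⁻¹ := by positivity
  have hinv1 : ω⁻¹ ≤ 1 := inv_le_one_of_one_le₀ hω
  have hb0 : 0 ≤ b := by linarith
  have hb1 : b < 1 := by linarith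
  have hsub : Set.Icc 0 b ⊆ Set.Ico 0 1 := fun t ht => ⟨ht.1, ht.2.trans_lt hb1⟩
  have h1 := abs_integral_mul_le_of_deriv_nonneg hb0 hω0 (fun t ht => hw t (hsub ht))
    (hw0 0 ⟨le_rfl, one_pos⟩) (fun t ht => hw' t (hsub ht)) (hcw.mono hsub) hT hT1 hτ
  have hpow : ω⁻¹ ^ ℓ / ω = ω ^ (-ℓ - 1) := by
    rw [Real.inv_rpow hω0.le, ← Real.rpow_neg hω0.le, Real.rpow_sub_one hω0.ne']
  have h1' : |∫ t in (0 : ℝ)..b, w t * τ t| ≤ 2 * ω ^ (-ℓ - 1) := by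
    refine h1.trans ?_
    rw [← hpow, mul_div_assoc]
    have := hle b ⟨hb0, hb1⟩
    rw [show 1 - b = ω⁻¹ by rw [hb]; ring] at this
    gcongr
  have h2 : |∫ t in b..1, w t * τ t| ≤ 1 / (ℓ + 1) * ω ^ (-ℓ - 1) := by
    have e : ∫ t in b..1, (1 - t) ^ ℓ = 1 / (ℓ + 1) * ω ^ (-ℓ - 1) := by
      rw [intervalIntegral.integral_comp_sub_left (fun t => t ^ ℓ) 1, sub_self,
        show 1 - b = ω⁻¹ by rw [hb]; ring, integral_rpow (Or.inl hℓ),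
        Real.zero_rpow (by linarith), Real.inv_rpow hω0.le, ← Real.rpow_neg hω0.le]
      rw [show -(ℓ + 1) = -ℓ - 1 by ring]
      ring
    rw [← e, ← Real.norm_eq_abs]
    refine intervalIntegral.norm_integral_le_of_norm_le hb1.le ?_
      (intervalIntegrable_one_sub_rpow hℓ)
    have hne : ∀ᵐ t : ℝ, t ≠ 1 := by simp [ae_iff]
    filter_upwards [hne] with t ht1 ht
    have htm : t ∈ Set.Ico (0 : ℝ) 1 := ⟨hb0.trans ht.1.le, lt_of_le_of_ne ht.2 ht1⟩
    rw [norm_mul, Real.norm_of_nonneg (hw0 t htm), Real.norm_eq_abs]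
    exact (mul_le_of_le_one_right (hw0 t htm) (hτ1 t)).trans (hle t htm)
  have hbu : b ∈ Set.uIcc (0 : ℝ) 1 := by
    rw [Set.uIcc_of_le zero_le_one]; exact ⟨hb0, hb1.le⟩
  rw [← intervalIntegral.integral_add_adjacent_intervals
    (hi.mono_set (Set.uIcc_subset_uIcc_left hbu)) (hi.mono_set (Set.uIcc_subset_uIcc_right hbu)),
    add_mul]
  exact (abs_add_le _ _).trans (add_le_add h1' h2)

lemma one_sub_sq_rpow_le {ℓ t : ℝ} (hℓ0 : ℓ ≤ 0) (ht : t ∈ Set.Ico (0 : ℝ) 1) :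
    (1 - t ^ 2) ^ ℓ ≤ (1 - t) ^ ℓ :=
  Real.rpow_le_rpow_of_nonpos (by linarith [ht.2]) (by nlinarith [ht.1, ht.2]) hℓ0

lemma one_sub_sq_pos {t : ℝ} (ht : t ∈ Set.Ico (0 : ℝ) 1) : 0 < 1 - t ^ 2 := by
  nlinarith [ht.1, ht.2]

lemma continuousOn_one_sub_sq_rpow (ℓ : ℝ) :
    ContinuousOn (fun t : ℝ => (1 - t ^ 2) ^ ℓ) (Set.Ico (0 : ℝ) 1) :=
  ContinuousOn.rpow_const (by fun_prop) fun _ ht => Or.inl (one_sub_sq_pos ht).ne'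

/-- For `ℓ ≤ 0` the weight increases and is dominated by `(1 - t)^ℓ`. The range `(-1, 0]` starts the
induction on `ℓ`. -/
lemma abs_powCos_le_of_nonpos {ℓ ω : ℝ} (hℓ : -1 < ℓ) (hℓ0 : ℓ ≤ 0) (hω : 1 ≤ ω) :
    |powCos ℓ ω| ≤ (2 + 1 / (ℓ + 1)) * ω ^ (-ℓ - 1) := by
  refine abs_integral_mul_le_of_le_rpow (T := fun t => Real.sin (ω * t)) hℓ hω
    (fun t ht => hasDerivAt_one_sub_sq_rpow ℓ ht.1 ht.2)
    (fun t ht => Real.rpow_nonneg (one_sub_sq_pos ht).le _) (fun t ht => ?_) ?_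
    (fun t ht => one_sub_sq_rpow_le hℓ0 ht) (intervalIntegrable_powCos hℓ ω) (fun t => ?_)
    (fun t => Real.abs_sin_le_one _) (fun t => Real.abs_cos_le_one _) (by fun_prop)
  · have h := Real.rpow_nonneg (one_sub_sq_pos ht).le (ℓ - 1)
    have := mul_nonneg (mul_nonneg (neg_nonneg.2 hℓ0) ht.1) h
    nlinarith
  · have := continuousOn_one_sub_sq_rpow (ℓ - 1)
    fun_prop
  · simpa [mul_comm] using ((hasDerivAt_id t).const_mul ω).sin

lemma abs_powSin_le_of_nonpos {ℓ ω : ℝ} (hℓ : -1 < ℓ) (hℓ0 : ℓ ≤ 0) (hω : 1 ≤ ω) :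
    |powSin ℓ ω| ≤ (2 + 1 / (ℓ + 1)) * ω ^ (-ℓ - 1) := by
  refine abs_integral_mul_le_of_le_rpow (T := fun t => -Real.cos (ω * t)) hℓ hω
    (fun t ht => (hasDerivAt_id t).mul (hasDerivAt_one_sub_sq_rpow ℓ ht.1 ht.2))
    (fun t ht => mul_nonneg ht.1 (Real.rpow_nonneg (one_sub_sq_pos ht).le _)) (fun t ht => ?_) ?_
    (fun t ht => ?_) (intervalIntegrable_powSin hℓ ω) (fun t => ?_)
    (fun t => by rw [abs_neg]; exact Real.abs_cos_le_one _) (fun t => Real.abs_sin_le_one _)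
    (by fun_prop)
  · have h := Real.rpow_nonneg (one_sub_sq_pos ht).le (ℓ - 1)
    have h' := Real.rpow_nonneg (one_sub_sq_pos ht).le ℓ
    have := mul_nonneg (mul_nonneg (neg_nonneg.2 hℓ0) (mul_nonneg ht.1 ht.1)) h
    simp only [id_eq]
    nlinarith
  · have := continuousOn_one_sub_sq_rpow (ℓ - 1)
    have := continuousOn_one_sub_sq_rpow ℓ
    simp only [id_eq]
    fun_prop
  · exact (mul_le_of_le_one_left (Real.rpow_nonneg (one_sub_sq_pos ht).le _) ht.2.le).trans
      (one_sub_sq_rpow_le hℓ0 ht)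
  · have h : HasDerivAt (fun t : ℝ => Real.cos (ω * t)) (-(ω * Real.sin (ω * t))) t := by
      simpa [mul_comm] using ((hasDerivAt_id t).const_mul ω).cos
    simpa using h.fun_neg

lemma abs_le_mul_rpow_of_abs_mul_le {A ℓ ω x : ℝ} (hω : 0 < ω) (h : |ω * x| ≤ A * ω ^ (-ℓ)) :
    |x| ≤ A * ω ^ (-ℓ - 1) := by
  rw [Real.rpow_sub_one hω.ne', ← mul_div_assoc, le_div_iff₀ hω]
  rwa [abs_mul, abs_of_pos hω, mul_comm] at h

/-- Both integrals are bounded together because each recursion involves the other: `powCos ℓ` comes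
from `powSin (ℓ - 1)`, then `powSin ℓ` from `powCos ℓ` and `powCos (ℓ - 1)`. The natural number only
counts unit steps down to `(-1, 0]`. -/
lemma exists_abs_powCos_powSin_le_nat (n : ℕ) : ∀ ℓ : ℝ, -1 < ℓ → ℓ ≤ n → ∃ C : ℝ, ∀ ω : ℝ, 1 ≤ ω →
    |powCos ℓ ω| ≤ C * ω ^ (-ℓ - 1) ∧ |powSin ℓ ω| ≤ C * ω ^ (-ℓ - 1) := by
  have base : ∀ ℓ : ℝ, -1 < ℓ → ℓ ≤ 0 → ∃ C : ℝ, ∀ ω : ℝ, 1 ≤ ω →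
      |powCos ℓ ω| ≤ C * ω ^ (-ℓ - 1) ∧ |powSin ℓ ω| ≤ C * ω ^ (-ℓ - 1) := fun ℓ hℓ hℓ0 =>
    ⟨_, fun ω hω => ⟨abs_powCos_le_of_nonpos hℓ hℓ0 hω, abs_powSin_le_of_nonpos hℓ hℓ0 hω⟩⟩
  induction n with
  | zero => exact fun ℓ hℓ hℓ0 => base ℓ hℓ (by simpa using hℓ0)
  | succ n ih =>
    intro ℓ hℓ hn
    rcases le_or_gt ℓ 0 with h0 | h0
    · exact base ℓ hℓ h0
    obtain ⟨C, hC⟩ := ih (ℓ - 1) (by linarith) (by push_cast at hn; linarith)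
    have hstep : ∀ ω : ℝ, 1 ≤ ω → |powCos ℓ ω| ≤ 2 * ℓ * C * ω ^ (-ℓ - 1) := by
      intro ω hω
      have hω0 : 0 < ω := by linarith
      have h := (hC ω hω).2
      rw [show -(ℓ - 1) - 1 = -ℓ by ring] at h
      refine abs_le_mul_rpow_of_abs_mul_le hω0 ?_
      rw [mul_powCos h0, abs_mul, abs_of_pos (by positivity), mul_assoc _ C]
      gcongr
    refine ⟨max (2 * ℓ * C) ((1 + 2 * ℓ) * (2 * ℓ * C) + 2 * ℓ * C), fun ω hω => ?_⟩
    have hω0 : 0 < ω := by linarith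
    have hp : 0 ≤ ω ^ (-ℓ - 1) := Real.rpow_nonneg hω0.le _
    refine ⟨(hstep ω hω).trans (mul_le_mul_of_nonneg_right (le_max_left _ _) hp), ?_⟩
    refine le_trans ?_ (mul_le_mul_of_nonneg_right (le_max_right _ _) hp)
    have h := (hC ω hω).1
    rw [show -(ℓ - 1) - 1 = -ℓ by ring] at h
    have h' := hstep ω hω
    have hC0 : 0 ≤ 2 * ℓ * C * ω ^ (-ℓ - 1) := (abs_nonneg _).trans h'
    -- The term `powCos ℓ` in `mul_powSin` is smaller by a factor `ω` than needed; the surplus is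
    -- discarded.
    have hle : ω ^ (-ℓ - 1) ≤ ω ^ (-ℓ) := Real.rpow_le_rpow_of_exponent_le hω (by linarith)
    have hCn : 0 ≤ C := by
      have : 0 ≤ C * ω ^ (-ℓ) := (abs_nonneg _).trans h
      exact nonneg_of_mul_nonneg_left this (by positivity)
    refine abs_le_mul_rpow_of_abs_mul_le hω0 ?_
    rw [mul_powSin h0, add_mul _ _ (ω ^ (-ℓ))]
    refine (abs_sub _ _).trans (add_le_add ?_ ?_)
    · rw [abs_mul, abs_of_pos (by positivity), mul_assoc (1 + 2 * ℓ)]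
      gcongr
      exact h'.trans (by gcongr)
    · rw [abs_mul, abs_of_pos (by positivity), mul_assoc _ C]
      gcongr

/-- The cosine integral of `(1 - t²)^ℓ` over `[0, 1]` is of order `ω^{-ℓ-1}`. -/
theorem exists_abs_powCos_le {ℓ : ℝ} (hℓ : -1 < ℓ) :
    ∃ C : ℝ, ∀ ω : ℝ, 1 ≤ ω → |powCos ℓ ω| ≤ C * ω ^ (-ℓ - 1) := by
  obtain ⟨C, hC⟩ := exists_abs_powCos_powSin_le_nat ⌈ℓ⌉₊ ℓ hℓ (Nat.le_ceil ℓ)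
  exact ⟨C, fun ω hω => (hC ω hω).1⟩

/-! ### The convolution as a cosine integral -/

section EvenFourier

variable {V : Type*} [NormedAddCommGroup V] [InnerProductSpace ℝ V] [MeasurableSpace V]
  [BorelSpace V] [FiniteDimensional ℝ V]

lemma integrable_mul_cos_inner {f : V → ℝ} (hi : Integrable f) (c : ℝ) (w : V) :
    Integrable fun v => f v * Real.cos (c * inner ℝ v w) :=
  hi.mul_bdd (c := 1) (by fun_prop) (ae_of_all _ fun _ => Real.abs_cos_le_one _)

lemma integral_mul_sin_inner_eq_zero {f : V → ℝ} (hf : ∀ v, f (-v) = f v) (c : ℝ) (w : V) :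
    ∫ v, f v * Real.sin (c * inner ℝ v w) = 0 := by
  have h := integral_neg_eq_self (fun v => f v * Real.sin (c * inner ℝ v w)) volume
  simp only [hf, inner_neg_left, mul_neg, Real.sin_neg, integral_neg] at h
  linarith

/-- The inverse Fourier transform of an even real function is its cosine transform. -/
lemma fourierInv_ofReal_of_even {f : V → ℝ} (hf : ∀ v, f (-v) = f v) (hi : Integrable f) (w : V) :
    𝓕⁻ (fun v => (f v : ℂ)) w = ((∫ v, f v * Real.cos (2 * Real.pi * inner ℝ v w) : ℝ) : ℂ) := by
  have hs : Integrable fun v => f v * Real.sin (2 * Real.pi * inner ℝ v w) :=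
    hi.mul_bdd (c := 1) (by fun_prop) (ae_of_all _ fun _ => Real.abs_sin_le_one _)
  have e : ∀ v, Complex.exp (((2 * Real.pi * inner ℝ v w : ℝ) : ℂ) * Complex.I) • (f v : ℂ) =
      ((f v * Real.cos (2 * Real.pi * inner ℝ v w) : ℝ) : ℂ) +
        ((f v * Real.sin (2 * Real.pi * inner ℝ v w) : ℝ) : ℂ) * Complex.I := by
    intro v
    rw [Complex.exp_mul_I, ← Complex.ofReal_cos, ← Complex.ofReal_sin, smul_eq_mul]
    push_cast
    ring
  rw [Real.fourierInv_eq']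
  simp_rw [e]
  rw [integral_add (integrable_mul_cos_inner hi _ w).ofReal (hs.ofReal.mul_const _),
    integral_mul_const, integral_complex_ofReal, integral_complex_ofReal,
    integral_mul_sin_inner_eq_zero hf]
  simp

lemma fourier_ofReal_of_even {f : V → ℝ} (hf : ∀ v, f (-v) = f v) (hi : Integrable f) (w : V) :
    𝓕 (fun v => (f v : ℂ)) w = ((∫ v, f v * Real.cos (2 * Real.pi * inner ℝ v w) : ℝ) : ℂ) := by
  have h := fourierInv_ofReal_of_even hf hi (-w)
  rw [Real.fourierInv_eq_fourier_neg, neg_neg] at h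
  simpa using h

end EvenFourier

lemma truncPow_neg (ℓ t : ℝ) : truncPow ℓ (-t) = truncPow ℓ t := by
  simp [truncPow]

lemma truncPow_nonneg (ℓ t : ℝ) : 0 ≤ truncPow ℓ t := by
  unfold truncPow
  split_ifs with h
  · exact Real.rpow_nonneg (by linarith) _
  · exact le_rfl

lemma truncPow_le_one {ℓ : ℝ} (hℓ : 0 ≤ ℓ) (t : ℝ) : truncPow ℓ t ≤ 1 := by
  unfold truncPow
  split_ifs with h
  · exact Real.rpow_le_one (by linarith) (by nlinarith [sq_nonneg t]) hℓ
  · exact zero_le_one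

lemma measurable_truncPow (ℓ : ℝ) : Measurable (truncPow ℓ) := by
  unfold truncPow
  exact Measurable.ite (measurableSet_le (by fun_prop) (by fun_prop)) (by fun_prop) (by fun_prop)

lemma truncPow_eq_zero {ℓ t : ℝ} (h : 1 < t ^ 2) : truncPow ℓ t = 0 := by
  simp [truncPow, not_le.2 h]

lemma integrable_truncPow {ℓ : ℝ} (hℓ : 0 ≤ ℓ) : Integrable (truncPow ℓ) := by
  have h : IntegrableOn (truncPow ℓ) (Set.Icc (-1) 1) :=
    Measure.integrableOn_of_bounded (M := 1) (by simp) (measurable_truncPow ℓ).aestronglyMeasurable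
      (ae_of_all _ fun t => by
        rw [Real.norm_of_nonneg (truncPow_nonneg ℓ t)]; exact truncPow_le_one hℓ t)
  refine (integrableOn_iff_integrable_of_support_subset fun t ht => ?_).1 h
  by_contra hn
  refine ht (truncPow_eq_zero ?_)
  rw [Set.mem_Icc, ← abs_le, not_le] at hn
  rw [← sq_abs]
  nlinarith

lemma continuousAt_truncPow {ℓ t : ℝ} (hℓ : 0 ≤ ℓ) (ht : t ^ 2 ≠ 1) :
    ContinuousAt (truncPow ℓ) t := by
  have hc : Continuous fun t : ℝ => t ^ 2 := by fun_prop
  rcases lt_or_gt_of_ne ht with h | h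
  · have hp : Continuous fun t : ℝ => (1 - t ^ 2) ^ ℓ :=
      Continuous.rpow_const (by fun_prop) fun _ => Or.inr hℓ
    refine hp.continuousAt.congr ?_
    filter_upwards [hc.continuousAt.eventually_lt continuousAt_const h] with u hu
    simp [truncPow, hu.le]
  · refine (continuousAt_const (y := (0 : ℝ))).congr ?_
    filter_upwards [continuousAt_const.eventually_lt hc.continuousAt h] with u hu
    exact (truncPow_eq_zero hu).symm

/-- Continuity is what makes Fourier inversion hold at every point rather than almost everywhere. -/
lemma continuous_selfConv {ℓ : ℝ} (hℓ : 0 ≤ ℓ) : Continuous (selfConv ℓ) := by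
  refine continuous_iff_continuousAt.2 fun r => ?_
  refine continuousAt_of_dominated (bound := truncPow ℓ) (Eventually.of_forall fun x => ?_)
    (Eventually.of_forall fun x => ae_of_all _ fun t => ?_) (integrable_truncPow hℓ) ?_
  · have := measurable_truncPow ℓ
    exact Measurable.aestronglyMeasurable (by fun_prop)
  · rw [Real.norm_of_nonneg (mul_nonneg (truncPow_nonneg _ _) (truncPow_nonneg _ _))]
    exact mul_le_of_le_one_right (truncPow_nonneg _ _) (truncPow_le_one hℓ _)
  -- For `ℓ = 0` the factor jumps where `r - t = ±1`, so continuity in `r` is available only off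
  -- these two values of `t`.
  · have hfin : ({r - 1, r + 1} : Set ℝ).Finite := by simp
    filter_upwards [hfin.countable.ae_notMem volume] with t ht
    simp only [Set.mem_insert_iff, Set.mem_singleton_iff, not_or] at ht
    have h1 : (r - t) ^ 2 ≠ 1 := by
      intro h
      rcases mul_self_eq_one_iff.1 (by rwa [← sq] : (r - t) * (r - t) = 1) with h | h
      · exact ht.1 (by linarith)
      · exact ht.2 (by linarith)
    have h2 : ContinuousAt (fun x : ℝ => truncPow ℓ (x - t)) r :=
      ContinuousAt.comp' (f := fun x : ℝ => x - t) (continuousAt_truncPow hℓ h1) (by fun_prop)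
    fun_prop

lemma continuous_powCos {ℓ : ℝ} (hℓ : 0 ≤ ℓ) : Continuous (powCos ℓ) := by
  refine intervalIntegral.continuous_parametric_intervalIntegral_of_continuous' ?_ 0 1
  refine Continuous.mul ?_ (by fun_prop)
  exact Continuous.rpow_const (by fun_prop) fun _ => Or.inr hℓ

lemma powCos_neg (ℓ ω : ℝ) : powCos ℓ (-ω) = powCos ℓ ω := by
  simp [powCos]

lemma powCos_abs (ℓ ω : ℝ) : powCos ℓ |ω| = powCos ℓ ω := by
  rcases abs_cases ω with h | h <;> simp [h.1, powCos_neg]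

lemma abs_powCos_le_one {ℓ : ℝ} (hℓ : 0 ≤ ℓ) (ω : ℝ) : |powCos ℓ ω| ≤ 1 := by
  have h := intervalIntegral.norm_integral_le_of_norm_le_const (a := (0 : ℝ)) (b := 1) (C := 1)
    (f := fun t : ℝ => (1 - t ^ 2) ^ ℓ * Real.cos (ω * t)) fun t ht => ?_
  · simpa [powCos] using h
  · rw [Set.uIoc_of_le zero_le_one] at ht
    have h0 : 0 ≤ 1 - t ^ 2 := by nlinarith [ht.1, ht.2]
    rw [norm_mul, Real.norm_of_nonneg (Real.rpow_nonneg h0 _), Real.norm_eq_abs]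
    exact mul_le_one₀ (Real.rpow_le_one h0 (by nlinarith [sq_nonneg t]) hℓ) (abs_nonneg _)
      (Real.abs_cos_le_one _)

/-- The square of the Fourier transform of the truncated power is of order `‖ω‖^{-2ℓ-2}`. -/
lemma exists_sq_powCos_le {ℓ : ℝ} (hℓ : 0 ≤ ℓ) :
    ∃ C : ℝ, 0 < C ∧ ∀ ω : ℝ, powCos ℓ ω ^ 2 ≤ C * (1 + ω ^ 2) ^ (-(ℓ + 1)) := by
  obtain ⟨C, hC⟩ := exists_abs_powCos_le (ℓ := ℓ) (by linarith)
  refine ⟨2 ^ (ℓ + 1) * max (C ^ 2) 1, by positivity, fun ω => ?_⟩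
  rw [← powCos_abs, ← sq_abs ω]
  obtain ⟨a, ha, ha0⟩ : ∃ a, |ω| = a ∧ 0 ≤ a := ⟨_, rfl, abs_nonneg ω⟩
  rw [ha, ← sq_abs]
  -- The number `(1 + a²)/2` is at most `1` for `a ≤ 1` and at most `a²` for `a ≥ 1`, so it serves
  -- as a common comparison; the factor `2^(ℓ+1)` pays for the halving.
  have h2 : ((1 + a ^ 2) / 2) ^ (-(ℓ + 1)) = 2 ^ (ℓ + 1) * (1 + a ^ 2) ^ (-(ℓ + 1)) := by
    rw [Real.div_rpow (by positivity) (by norm_num), Real.rpow_neg (by norm_num : (0 : ℝ) ≤ 2)]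
    field_simp
  rw [mul_right_comm, ← h2, mul_comm]
  rcases le_total a 1 with h1 | h1
  · have hb : (1 : ℝ) ≤ ((1 + a ^ 2) / 2) ^ (-(ℓ + 1)) :=
      Real.one_le_rpow_of_pos_of_le_one_of_nonpos (by positivity) (by nlinarith) (by linarith)
    calc |powCos ℓ a| ^ 2 ≤ 1 := pow_le_one₀ (abs_nonneg _) (abs_powCos_le_one hℓ a)
      _ ≤ max (C ^ 2) 1 * ((1 + a ^ 2) / 2) ^ (-(ℓ + 1)) :=
        one_le_mul_of_one_le_of_one_le (le_max_right _ _) hb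
  · have hb : (a ^ 2) ^ (-(ℓ + 1)) ≤ ((1 + a ^ 2) / 2) ^ (-(ℓ + 1)) :=
      Real.rpow_le_rpow_of_nonpos (by positivity) (by nlinarith) (by linarith)
    calc |powCos ℓ a| ^ 2 ≤ (C * a ^ (-ℓ - 1)) ^ 2 := by gcongr; exact hC a h1
      _ = C ^ 2 * (a ^ 2) ^ (-(ℓ + 1)) := by
        rw [mul_pow, ← Real.rpow_natCast (a ^ (-ℓ - 1)), ← Real.rpow_natCast a,
          ← Real.rpow_mul ha0, ← Real.rpow_mul ha0]
        ring_nf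
      _ ≤ _ := by gcongr; exact le_max_left _ _

/-- The squared transform of `f_ℓ`, as a radial function, is integrable in dimension below `2ℓ + 2`. -/
lemma integrable_sq_powCos_norm {V : Type*} [NormedAddCommGroup V] [NormedSpace ℝ V]
    [FiniteDimensional ℝ V] [MeasurableSpace V] [BorelSpace V] (μ : Measure V) [μ.IsAddHaarMeasure]
    {ℓ : ℝ} (hℓ : 0 ≤ ℓ) (hd : (Module.finrank ℝ V : ℝ) < 2 * (ℓ + 1)) :
    Integrable (fun v : V => powCos ℓ ‖v‖ ^ 2) μ := by
  obtain ⟨C, hC0, hC⟩ := exists_sq_powCos_le hℓ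
  have hi := (integrable_rpow_neg_one_add_norm_sq (μ := μ) hd).const_mul C
  have hc := continuous_powCos hℓ
  refine hi.mono' (by fun_prop) (ae_of_all _ fun v => ?_)
  rw [Real.norm_of_nonneg (sq_nonneg _)]
  convert! hC ‖v‖ using 3
  ring

lemma integral_truncPow_mul_cos (ℓ ω : ℝ) :
    ∫ t : ℝ, truncPow ℓ t * Real.cos (ω * t) = 2 * powCos ℓ ω := by
  have h := integral_comp_abs (f := fun t => truncPow ℓ t * Real.cos (ω * t))
  have e : ∀ t : ℝ, truncPow ℓ |t| * Real.cos (ω * |t|) = truncPow ℓ t * Real.cos (ω * t) := by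
    intro t
    rcases abs_cases t with h | h <;> simp [h.1, truncPow_neg]
  simp_rw [e] at h
  rw [h, powCos, intervalIntegral.integral_of_le zero_le_one]
  congr 1
  rw [setIntegral_eq_of_subset_of_forall_sdiff_eq_zero (s := Set.Ioc 0 1) measurableSet_Ioi
    Set.Ioc_subset_Ioi_self]
  · refine setIntegral_congr_fun measurableSet_Ioc fun t ht => ?_
    have : t ^ 2 ≤ 1 := by nlinarith [ht.1, ht.2]
    simp [truncPow, this]
  · intro t ht
    have h1 : 1 < t := by
      by_contra hn
      exact ht.2 ⟨ht.1, not_lt.1 hn⟩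
    rw [truncPow_eq_zero (by nlinarith), zero_mul]

/-- Fourier inversion for the convolution square of the truncated power. -/
theorem selfConv_eq_integral {ℓ : ℝ} (hℓ : 0 ≤ ℓ) (r : ℝ) :
    selfConv ℓ r =
      ∫ ω in Set.Ioi (0 : ℝ), 4 / Real.pi * powCos ℓ ω ^ 2 * Real.cos (ω * r) := by
  set f : ℝ → ℂ := fun t => (truncPow ℓ t : ℂ) with hfdef
  have hf : Integrable f := (integrable_truncPow hℓ).ofReal
  have hconv : (fun r => (selfConv ℓ r : ℂ)) =
      convolution f f (ContinuousLinearMap.mul ℂ ℂ) volume := by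
    ext x
    rw [convolution_def, selfConv, ← integral_complex_ofReal]
    simp [f]
  have hF : 𝓕 f = fun ξ => ((2 * powCos ℓ (2 * Real.pi * ξ) : ℝ) : ℂ) := by
    ext ξ
    rw [fourier_ofReal_of_even (truncPow_neg ℓ) (integrable_truncPow hℓ),
      ← integral_truncPow_mul_cos]
    simp [mul_assoc]
  set P : ℝ → ℝ := fun ξ => 4 * powCos ℓ (2 * Real.pi * ξ) ^ 2 with hP
  have hFF : 𝓕 (fun r => (selfConv ℓ r : ℂ)) = fun ξ => (P ξ : ℂ) := by
    ext ξ
    rw [hconv, Real.fourier_mul_convolution_eq hf hf, hF]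
    simp only [hP]
    push_cast
    ring
  have hPi : Integrable P := by
    have h : Integrable (fun v : ℝ => powCos ℓ ‖v‖ ^ 2) :=
      integrable_sq_powCos_norm volume hℓ (by simp; linarith)
    simp_rw [Real.norm_eq_abs, powCos_abs] at h
    exact (h.comp_mul_left' (by positivity : 2 * Real.pi ≠ 0)).const_mul 4
  have hint : Integrable (fun r => (selfConv ℓ r : ℂ)) := by
    rw [hconv]
    exact hf.integrable_convolution _ hf
  have hcont : Continuous (fun r => (selfConv ℓ r : ℂ)) :=
    Complex.continuous_ofReal.comp (continuous_selfConv hℓ)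
  have hinv := congrFun (hcont.fourierInv_fourier_eq hint (by rw [hFF]; exact hPi.ofReal)) r
  rw [hFF, fourierInv_ofReal_of_even (fun v => by simp [hP, powCos_neg]) hPi] at hinv
  rw [← Complex.ofReal_injective hinv]
  -- Folding to the half-line gives a factor `2` and `ω = 2πξ` a factor `1/(2π)`, which turn `4`
  -- into `4/π`.
  have habs := integral_comp_abs
    (f := fun ξ => 4 * powCos ℓ (2 * Real.pi * ξ) ^ 2 * Real.cos (2 * Real.pi * ξ * r))
  have e : ∀ ξ : ℝ, 4 * powCos ℓ (2 * Real.pi * |ξ|) ^ 2 * Real.cos (2 * Real.pi * |ξ| * r) =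
      P ξ * Real.cos (2 * Real.pi * inner ℝ ξ r) := by
    intro ξ
    rcases abs_cases ξ with h | h <;> simp [h.1, powCos_neg, hP, mul_assoc, mul_comm r]
  simp_rw [e] at habs
  rw [habs, integral_comp_mul_left_Ioi (fun ω => 4 * powCos ℓ ω ^ 2 * Real.cos (ω * r)) 0
    (by positivity : 0 < 2 * Real.pi), mul_zero, smul_eq_mul, ← mul_assoc, ← integral_const_mul]
  congr 1
  ext ω
  field_simp

/-! ### The Wu functions as radial Fourier integrals -/

/-- The Poisson integral `∫_0^π sin^m θ cos(z cos θ) dθ`. -/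
def poissonIntegral (m : ℕ) (z : ℝ) : ℝ :=
  ∫ θ in (0 : ℝ)..Real.pi, Real.sin θ ^ m * Real.cos (z * Real.cos θ)

lemma abs_poissonIntegral_le (m : ℕ) (z : ℝ) : |poissonIntegral m z| ≤ Real.pi := by
  have h := intervalIntegral.norm_integral_le_of_norm_le_const (a := (0 : ℝ)) (b := Real.pi)
    (C := 1) (f := fun θ : ℝ => Real.sin θ ^ m * Real.cos (z * Real.cos θ)) fun θ _ => ?_
  · simpa [poissonIntegral, abs_of_pos Real.pi_pos] using h
  · rw [norm_mul, norm_pow, Real.norm_eq_abs, Real.norm_eq_abs]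
    exact mul_le_one₀ (pow_le_one₀ (abs_nonneg _) (Real.abs_sin_le_one _)) (abs_nonneg _)
      (Real.abs_cos_le_one _)

/-- Integration by parts against `sin^{m+1} θ / (m+1)`, which vanishes at `0` and `π`. It makes
differentiation of the Poisson integral raise `m` by two. -/
lemma integral_sin_pow_mul_cos_mul_sin (m : ℕ) (z : ℝ) :
    ∫ θ in (0 : ℝ)..Real.pi, Real.sin θ ^ m * (Real.cos θ * Real.sin (z * Real.cos θ)) =
      z / (m + 1) * poissonIntegral (m + 2) z := by
  have hm : (m + 1 : ℝ) ≠ 0 := by positivity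
  have hu : ∀ θ : ℝ, HasDerivAt (fun θ => Real.sin θ ^ (m + 1) / (m + 1))
      (Real.sin θ ^ m * Real.cos θ) θ := fun θ => by
    have := ((Real.hasDerivAt_sin θ).pow (m + 1)).div_const (m + 1 : ℝ)
    simp only [Nat.cast_add, Nat.cast_one, Nat.add_sub_cancel] at this
    convert! this using 1
    field_simp
  have hv : ∀ θ : ℝ, HasDerivAt (fun θ => Real.sin (z * Real.cos θ))
      (Real.cos (z * Real.cos θ) * (z * -Real.sin θ)) θ := fun θ =>
    ((Real.hasDerivAt_cos θ).const_mul z).sin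
  have parts := intervalIntegral.integral_deriv_mul_eq_sub
    (a := 0) (b := Real.pi) (fun θ _ => hu θ) (fun θ _ => hv θ)
    ((by fun_prop : Continuous fun θ => Real.sin θ ^ m * Real.cos θ).intervalIntegrable _ _)
    ((by fun_prop : Continuous fun θ => Real.cos (z * Real.cos θ) *
      (z * -Real.sin θ)).intervalIntegrable _ _)
  simp only [Real.sin_pi, Real.sin_zero, ne_eq, Nat.add_eq_zero_iff, one_ne_zero, and_false,
    not_false_eq_true, zero_pow, zero_div, zero_mul, sub_self] at parts
  rw [intervalIntegral.integral_add
    ((by fun_prop : Continuous _).intervalIntegrable _ _)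
    ((by fun_prop : Continuous _).intervalIntegrable _ _)] at parts
  rw [poissonIntegral, ← intervalIntegral.integral_const_mul]
  have e1 : (fun θ : ℝ => Real.sin θ ^ m * (Real.cos θ * Real.sin (z * Real.cos θ))) =
      fun θ => Real.sin θ ^ m * Real.cos θ * Real.sin (z * Real.cos θ) := by
    ext θ; ring
  have e2 : (fun θ : ℝ => Real.sin θ ^ (m + 1) / (m + 1) *
      (Real.cos (z * Real.cos θ) * (z * -Real.sin θ))) =
      fun θ => -(z / (m + 1) * (Real.sin θ ^ (m + 2) * Real.cos (z * Real.cos θ))) := by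
    ext θ; ring
  rw [e1]
  rw [e2, intervalIntegral.integral_neg] at parts
  linarith

lemma hasDerivAt_poissonIntegral (m : ℕ) (z : ℝ) :
    HasDerivAt (poissonIntegral m) (-(z / (m + 1) * poissonIntegral (m + 2) z)) z := by
  have h := (intervalIntegral.hasDerivAt_integral_of_dominated_loc_of_deriv_le (μ := volume)
    (a := 0) (b := Real.pi) (x₀ := z) (s := Set.univ)
    (F := fun z θ => Real.sin θ ^ m * Real.cos (z * Real.cos θ))
    (F' := fun z θ => -(Real.sin θ ^ m * (Real.cos θ * Real.sin (z * Real.cos θ))))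
    (bound := fun _ => 1) univ_mem
    (Eventually.of_forall fun x => by fun_prop)
    ((by fun_prop : Continuous _).intervalIntegrable _ _) (by fun_prop)
    (ae_of_all _ fun θ _ x _ => ?_) (by simp) (ae_of_all _ fun θ _ x _ => ?_)).2
  · rw [intervalIntegral.integral_neg, integral_sin_pow_mul_cos_mul_sin] at h
    exact h
  · rw [norm_neg, norm_mul, norm_mul, norm_pow, Real.norm_eq_abs, Real.norm_eq_abs,
      Real.norm_eq_abs]
    exact mul_le_one₀ (pow_le_one₀ (abs_nonneg _) (Real.abs_sin_le_one _)) (by positivity)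
      (mul_le_one₀ (Real.abs_cos_le_one _) (abs_nonneg _) (Real.abs_sin_le_one _))
  · have h1 : HasDerivAt (fun x : ℝ => x * Real.cos θ) (Real.cos θ) x := by
      simpa using (hasDerivAt_id x).mul_const (Real.cos θ)
    convert! h1.cos.const_mul (Real.sin θ ^ m) using 1
    ring

/-- For `m = 1` the integrand is, up to the factor `-z`, the derivative of `sin(z cos θ)`. This
links the cosine to the Poisson integrals. -/
lemma mul_poissonIntegral_one (z : ℝ) : z * poissonIntegral 1 z = 2 * Real.sin z := by
  have h := intervalIntegral.integral_eq_sub_of_hasDerivAt (a := 0) (b := Real.pi)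
    (f := fun θ => Real.sin (z * Real.cos θ))
    (f' := fun θ => -(z * (Real.sin θ ^ 1 * Real.cos (z * Real.cos θ))))
    (fun θ _ => by
      convert! ((Real.hasDerivAt_cos θ).const_mul z).sin using 1
      ring) ((by fun_prop : Continuous _).intervalIntegrable _ _)
  rw [intervalIntegral.integral_neg, intervalIntegral.integral_const_mul] at h
  simp only [Real.cos_pi, Real.cos_zero, mul_neg, mul_one, Real.sin_neg] at h
  rw [poissonIntegral]
  linarith

/-- The normalizing constant of `radialKernel`. -/
def radialConst : ℕ → ℝ
  | 0 => 1 / 2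
  | k + 1 => radialConst k / (2 * k + 2)

lemma radialConst_pos (k : ℕ) : 0 < radialConst k := by
  induction k with
  | zero => simp [radialConst]
  | succ k ih => rw [radialConst]; positivity

/-- The function `𝒟^k cos`, the kernel of the Fourier transform of radial functions on
`ℝ^{2k+1}` up to a constant. -/
def radialKernel : ℕ → ℝ → ℝ
  | 0 => Real.cos
  | k + 1 => fun z => radialConst k * poissonIntegral (2 * k + 1) z

/-- The constants `radialConst` are chosen for this recursion: `1/2` cancels the `2` of
`mul_poissonIntegral_one`, and `1/(2k+2)` is the `1/(m+1)` for `m = 2k+1`. The undivided form also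
covers `z = 0`. -/
lemma hasDerivAt_radialKernel (k : ℕ) (z : ℝ) :
    HasDerivAt (radialKernel k) (-(z * radialKernel (k + 1) z)) z := by
  cases k with
  | zero =>
    convert! Real.hasDerivAt_cos z using 2
    have := mul_poissonIntegral_one z
    simp only [radialKernel, radialConst]
    linarith
  | succ k =>
    convert! (hasDerivAt_poissonIntegral (2 * k + 1) z).const_mul (radialConst k) using 1
    simp only [radialKernel, radialConst]
    push_cast
    rw [show 2 * (k + 1) + 1 = 2 * k + 1 + 2 by ring]
    have : (2 * k + 2 : ℝ) ≠ 0 := by positivity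
    field_simp
    ring

lemma continuous_radialKernel (k : ℕ) : Continuous (radialKernel k) :=
  continuous_iff_continuousAt.2 fun z => (hasDerivAt_radialKernel k z).continuousAt

lemma exists_abs_radialKernel_le (k : ℕ) : ∃ B : ℝ, ∀ z, |radialKernel k z| ≤ B := by
  cases k with
  | zero => exact ⟨1, Real.abs_cos_le_one⟩
  | succ k =>
    refine ⟨radialConst k * Real.pi, fun z => ?_⟩
    rw [radialKernel, abs_mul, abs_of_pos (radialConst_pos k)]
    exact mul_le_mul_of_nonneg_left (abs_poissonIntegral_le _ _) (radialConst_pos k).le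

/-- The radial Fourier integral of the weight `w` in dimension `2k+1`. -/
def radialIntegral (w : ℝ → ℝ) (k : ℕ) (r : ℝ) : ℝ :=
  ∫ ω in Set.Ioi (0 : ℝ), w ω * ω ^ (2 * k) * radialKernel k (ω * r)

section RadialIntegral

variable {w : ℝ → ℝ} {k : ℕ}

lemma integrableOn_radial_mul_kernel
    (hi : IntegrableOn (fun ω => w ω * ω ^ (2 * k)) (Set.Ioi 0)) (r : ℝ) :
    IntegrableOn (fun ω => w ω * ω ^ (2 * k) * radialKernel k (ω * r)) (Set.Ioi 0) := by
  obtain ⟨B, hB⟩ := exists_abs_radialKernel_le k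
  have := continuous_radialKernel k
  exact hi.mul_bdd (c := B) (by fun_prop) (ae_of_all _ fun ω => hB _)

lemma continuous_radialIntegral (hi : IntegrableOn (fun ω => w ω * ω ^ (2 * k)) (Set.Ioi 0)) :
    Continuous (radialIntegral w k) := by
  obtain ⟨B, hB⟩ := exists_abs_radialKernel_le k
  have hc := continuous_radialKernel k
  refine continuous_of_dominated (bound := fun ω => |w ω * ω ^ (2 * k)| * B) (fun r => ?_)
    (fun r => ae_of_all _ fun ω => ?_) (hi.abs.mul_const B) (ae_of_all _ fun ω => by fun_prop)
  · exact (integrableOn_radial_mul_kernel hi r).aestronglyMeasurable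
  · rw [norm_mul, Real.norm_eq_abs, Real.norm_eq_abs]
    exact mul_le_mul_of_nonneg_left (hB _) (abs_nonneg _)

/-- The chain rule gives one factor `ω` and the kernel recursion the factor `ω r`, hence the next
even moment of `w`, whose integrability justifies differentiating under the integral. -/
lemma hasDerivAt_radialIntegral (hi : IntegrableOn (fun ω => w ω * ω ^ (2 * k)) (Set.Ioi 0))
    (hi' : IntegrableOn (fun ω => w ω * ω ^ (2 * (k + 1))) (Set.Ioi 0)) (r : ℝ) :
    HasDerivAt (radialIntegral w k) (-(r * radialIntegral w (k + 1) r)) r := by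
  obtain ⟨B, hB⟩ := exists_abs_radialKernel_le (k + 1)
  have h := (hasDerivAt_integral_of_dominated_loc_of_deriv_le
    (μ := volume.restrict (Set.Ioi (0 : ℝ))) (x₀ := r) (s := Metric.ball r 1)
    (F := fun r ω => w ω * ω ^ (2 * k) * radialKernel k (ω * r))
    (F' := fun r ω => -r * (w ω * ω ^ (2 * (k + 1)) * radialKernel (k + 1) (ω * r)))
    (bound := fun ω => (|r| + 1) * (|w ω * ω ^ (2 * (k + 1))| * B))
    (Metric.ball_mem_nhds r one_pos)
    (Eventually.of_forall fun x => (integrableOn_radial_mul_kernel hi x).aestronglyMeasurable)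
    (integrableOn_radial_mul_kernel hi r)
    ((integrableOn_radial_mul_kernel hi' r).const_mul (-r)).aestronglyMeasurable
    (ae_of_all _ fun ω x hx => ?_) ((hi'.abs.mul_const B).const_mul _)
    (ae_of_all _ fun ω x _ => ?_)).2
  · rw [integral_const_mul, neg_mul] at h
    exact h
  · rw [norm_mul, norm_mul, norm_neg, Real.norm_eq_abs, Real.norm_eq_abs, Real.norm_eq_abs]
    rw [Metric.mem_ball, Real.dist_eq] at hx
    have hx' : |x| ≤ |r| + 1 := by
      have := abs_sub_abs_le_abs_sub x r
      linarith
    have := hB (ω * x)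
    gcongr
  · have h1 : HasDerivAt (fun x : ℝ => ω * x) ω x := by
      simpa using (hasDerivAt_id x).const_mul ω
    convert! ((hasDerivAt_radialKernel k (ω * x)).comp x h1).const_mul (w ω * ω ^ (2 * k)) using 1
    ring

/-- The dimension walk on radial Fourier integrals. -/
lemma dimWalk_radialIntegral (hi : IntegrableOn (fun ω => w ω * ω ^ (2 * k)) (Set.Ioi 0))
    (hi' : IntegrableOn (fun ω => w ω * ω ^ (2 * (k + 1))) (Set.Ioi 0)) :
    dimWalk (radialIntegral w k) = radialIntegral w (k + 1) := by
  have hq : ∀ t : ℝ, t ≠ 0 → -(deriv (radialIntegral w k) t) / t = radialIntegral w (k + 1) t := by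
    intro t ht
    rw [(hasDerivAt_radialIntegral hi hi' t).deriv, neg_neg, mul_div_cancel_left₀ _ ht]
  ext r
  unfold dimWalk
  split_ifs with hr
  · subst hr
    -- The limit prescribed at `0` exists because the next radial integral is continuous there.
    refine Tendsto.limUnder_eq ?_
    have hc := ((continuous_radialIntegral hi').tendsto 0).mono_left
      (nhdsWithin_le_nhds (s := Set.Ioi 0))
    refine hc.congr' ?_
    filter_upwards [self_mem_nhdsWithin] with t ht
    exact (hq t (ne_of_gt ht)).symm
  · exact hq r hr

end RadialIntegral

/-- The factor `ω^{2j}` is the polar density of `ℝ^{2j+1}`, so this is radial integrability in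
dimension `2j+1 < 2ℓ+2`. -/
lemma integrableOn_spectralWeight {ℓ : ℝ} {j : ℕ} (hj : (j : ℝ) ≤ ℓ) :
    IntegrableOn (fun ω => 4 / Real.pi * powCos ℓ ω ^ 2 * ω ^ (2 * j)) (Set.Ioi 0) := by
  have hℓ : 0 ≤ ℓ := j.cast_nonneg.trans hj
  have h := integrable_sq_powCos_norm (V := E (2 * j + 1)) volume hℓ (by
    rw [finrank_euclideanSpace_fin]; push_cast; linarith)
  rw [integrable_fun_norm_addHaar volume (f := fun ρ : ℝ => powCos ℓ ρ ^ 2),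
    finrank_euclideanSpace_fin] at h
  refine (h.const_mul (4 / Real.pi)).congr (ae_of_all _ fun ω => ?_)
  simp only [Nat.add_sub_cancel, smul_eq_mul]
  ring

/-- The Wu function as the radial Fourier integral of the squared transform of `f_ℓ`. -/
theorem wu_eq_radialIntegral {ℓ : ℝ} {k : ℕ} (hk : (k : ℝ) ≤ ℓ) :
    wu ℓ k = radialIntegral (fun ω => 4 / Real.pi * powCos ℓ ω ^ 2) k := by
  induction k with
  | zero =>
    ext r
    simp only [Nat.cast_zero] at hk
    simp [wu, radialIntegral, radialKernel, selfConv_eq_integral hk]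
  | succ k ih =>
    have hk' : (k : ℝ) ≤ ℓ := le_trans (by push_cast; linarith) hk
    have hw : wu ℓ (k + 1) = dimWalk (wu ℓ k) := Function.iterate_succ_apply' _ _ _
    rw [hw, ih hk', dimWalk_radialIntegral (integrableOn_spectralWeight hk')
      (integrableOn_spectralWeight hk)]

/-! ### The Fourier transform of radial functions in odd dimension -/

/-- Splitting off the first coordinate of a Euclidean space. -/
def splitFirst (n : ℕ) : E (n + 1) ≃ᵐ ℝ × E n :=
  (MeasurableEquiv.toLp 2 (Fin (n + 1) → ℝ)).symm.trans
    ((MeasurableEquiv.piFinSuccAbove (fun _ => ℝ) 0).trans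
      ((MeasurableEquiv.refl ℝ).prodCongr (MeasurableEquiv.toLp 2 (Fin n → ℝ))))

lemma splitFirst_fst (n : ℕ) (v : E (n + 1)) : (splitFirst n v).1 = v 0 := rfl

lemma splitFirst_snd (n : ℕ) (v : E (n + 1)) (i : Fin n) : (splitFirst n v).2 i = v i.succ := rfl

lemma norm_eq_splitFirst (n : ℕ) (v : E (n + 1)) :
    ‖v‖ = √((splitFirst n v).1 ^ 2 + ‖(splitFirst n v).2‖ ^ 2) := by
  rw [EuclideanSpace.norm_eq, EuclideanSpace.norm_sq_eq, Fin.sum_univ_succ]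
  simp [splitFirst_fst, splitFirst_snd]

lemma measurePreserving_splitFirst (n : ℕ) : MeasurePreserving (splitFirst n) volume volume := by
  have h1 := EuclideanSpace.volume_preserving_symm_measurableEquiv_toLp (Fin (n + 1))
  have h2 := volume_preserving_piFinSuccAbove (fun _ : Fin (n + 1) => ℝ) 0
  have h3 := (EuclideanSpace.volume_preserving_symm_measurableEquiv_toLp (Fin n)).symm
  exact (((MeasurePreserving.id (volume : Measure ℝ)).prod h3).comp h2).comp h1

/-- Rotating the frequency of a radial cosine integral onto the first coordinate axis. -/
lemma integral_radial_mul_cos_inner_eq (n : ℕ) (G : ℝ → ℝ) (x : E (n + 1)) :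
    ∫ v : E (n + 1), G ‖v‖ * Real.cos (inner ℝ v x) =
      ∫ v : E (n + 1), G ‖v‖ * Real.cos (v 0 * ‖x‖) := by
  set y : E (n + 1) := EuclideanSpace.single 0 ‖x‖ with hy
  have hxy : ‖x‖ = ‖y‖ := by simp [hy]
  -- The reflection in the hyperplane orthogonal to `x - y` maps `x` to `y`, as both have the same
  -- norm.
  set T := (ℝ ∙ (x - y))ᗮ.reflection
  have hT : T x = y := Submodule.reflection_sub hxy
  have h := T.measurePreserving.integral_comp T.toHomeomorph.measurableEmbedding
    (fun v : E (n + 1) => G ‖v‖ * Real.cos (inner ℝ v y))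
  calc ∫ v : E (n + 1), G ‖v‖ * Real.cos (inner ℝ v x)
      = ∫ v : E (n + 1), G ‖T v‖ * Real.cos (inner ℝ (T v) y) := by
        simp_rw [← hT, LinearIsometryEquiv.inner_map_map, LinearIsometryEquiv.norm_map]
    _ = ∫ v : E (n + 1), G ‖v‖ * Real.cos (inner ℝ v y) := h
    _ = _ := by simp [hy, EuclideanSpace.inner_single_right, mul_comm]

lemma integral_radial_mul_cos_dim_one (G : ℝ → ℝ) (x : E 1) :
    ∫ v : E 1, G ‖v‖ * Real.cos (inner ℝ v x) = 2 * radialIntegral G 0 ‖x‖ := by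
  rw [integral_radial_mul_cos_inner_eq 0]
  have hp : MeasurePreserving ((MeasurableEquiv.toLp 2 (Fin 1 → ℝ)).symm.trans
      (MeasurableEquiv.funUnique (Fin 1) ℝ)) volume volume :=
    (volume_preserving_funUnique (Fin 1) ℝ).comp
      (EuclideanSpace.volume_preserving_symm_measurableEquiv_toLp (Fin 1))
  have h := hp.integral_comp' (fun t : ℝ => G |t| * Real.cos (|t| * ‖x‖))
  rw [integral_comp_abs (f := fun t => G t * Real.cos (t * ‖x‖))] at h
  rw [radialIntegral]
  simp only [mul_zero, pow_zero, mul_one, radialKernel]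
  rw [← h]
  congr 1
  ext v
  have hv : ‖v‖ = |v 0| := by
    rw [EuclideanSpace.norm_eq]; simp [Real.sqrt_sq_eq_abs]
  have hc : Real.cos (|v 0| * ‖x‖) = Real.cos (v 0 * ‖x‖) := by
    rcases abs_cases (v 0) with h | h <;> simp [h.1]
  rw [hv, ← hc]
  rfl

section Slice

variable {n : ℕ} {G : ℝ → ℝ}

/-- Polar coordinates in the last `n` variables carry integrability over to the half-plane, which is
what Fubini needs in the planar reduction. -/
lemma pow_mul_comp_integrable (hn : 0 < n) (hG : Continuous G)
    (hi : Integrable fun v : E (n + 1) => G ‖v‖) :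
    Integrable (fun q : ℝ × ℝ => q.2 ^ (n - 1) * G √(q.1 ^ 2 + q.2 ^ 2))
      ((volume : Measure ℝ).prod (volume.restrict (Set.Ioi 0))) := by
  have : Nonempty (Fin n) := ⟨⟨0, hn⟩⟩
  have hi' : Integrable (fun q : ℝ × E n => G √(q.1 ^ 2 + ‖q.2‖ ^ 2))
      ((volume : Measure ℝ).prod volume) := by
    refine ((measurePreserving_splitFirst n).integrable_comp_emb
      (splitFirst n).measurableEmbedding).1 (hi.congr (ae_of_all _ fun v => ?_))
    simp only [Function.comp_apply, norm_eq_splitFirst n v]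
  rw [integrable_prod_iff (by fun_prop)]
  constructor
  · filter_upwards [hi'.prod_right_ae] with t ht
    rw [integrable_fun_norm_addHaar volume (f := fun s : ℝ => G √(t ^ 2 + s ^ 2)),
      finrank_euclideanSpace_fin] at ht
    exact ht
  · have h := hi'.norm.integral_prod_left
    have e : ∀ t : ℝ, ∫ η : E n, ‖G √(t ^ 2 + ‖η‖ ^ 2)‖ =
        n * (volume.real (Metric.ball (0 : E n) 1)) *
          ∫ s in Set.Ioi (0 : ℝ), ‖s ^ (n - 1) * G √(t ^ 2 + s ^ 2)‖ := by
      intro t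
      rw [integral_fun_norm_addHaar volume (fun s : ℝ => ‖G √(t ^ 2 + s ^ 2)‖),
        finrank_euclideanSpace_fin, nsmul_eq_mul, smul_eq_mul, mul_assoc]
      congr 2
      refine setIntegral_congr_fun measurableSet_Ioi fun s hs => ?_
      rw [norm_mul, Real.norm_of_nonneg (pow_nonneg (le_of_lt hs) _), smul_eq_mul]
    simp only [e] at h
    have hpos : 0 < (n : ℝ) * volume.real (Metric.ball (0 : E n) 1) :=
      mul_pos (by exact_mod_cast hn) (ENNReal.toReal_pos
        (Metric.measure_ball_pos _ _ one_pos).ne' measure_ball_lt_top.ne)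
    exact (integrable_const_mul_iff hpos.ne'.isUnit _).1 h

/-- The radial cosine integral on `ℝ^{n+1}` as a planar integral. -/
lemma integral_radial_mul_cos_eq_planar (hn : 0 < n) (hG : Continuous G)
    (hi : Integrable fun v : E (n + 1) => G ‖v‖) (R : ℝ) :
    ∫ v : E (n + 1), G ‖v‖ * Real.cos (v 0 * R) =
      n * volume.real (Metric.ball (0 : E n) 1) *
        ∫ q in Set.univ ×ˢ Set.Ioi (0 : ℝ),
          q.2 ^ (n - 1) * G √(q.1 ^ 2 + q.2 ^ 2) * Real.cos (q.1 * R) := by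
  have : Nonempty (Fin n) := ⟨⟨0, hn⟩⟩
  have hi' : Integrable (fun q : ℝ × E n => G √(q.1 ^ 2 + ‖q.2‖ ^ 2) * Real.cos (q.1 * R))
      ((volume : Measure ℝ).prod volume) := by
    refine ((measurePreserving_splitFirst n).integrable_comp_emb
      (splitFirst n).measurableEmbedding).1 ?_
    refine (hi.mul_bdd (c := 1) (g := fun v : E (n + 1) => Real.cos (v 0 * R))
      (by fun_prop) (ae_of_all _ fun v => Real.abs_cos_le_one _)).congr (ae_of_all _ fun v => ?_)
    simp only [Function.comp_apply, norm_eq_splitFirst n v, splitFirst_fst]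
  have hp := (pow_mul_comp_integrable hn hG hi).mul_bdd (c := 1)
    (g := fun q : ℝ × ℝ => Real.cos (q.1 * R)) (by fun_prop)
    (ae_of_all _ fun v => Real.abs_cos_le_one _)
  have h1 := (measurePreserving_splitFirst n).integral_comp'
    (fun q : ℝ × E n => G √(q.1 ^ 2 + ‖q.2‖ ^ 2) * Real.cos (q.1 * R))
  simp only [← norm_eq_splitFirst] at h1
  simp only [splitFirst_fst] at h1
  rw [h1, Measure.volume_eq_prod, integral_prod _ hi', Measure.volume_eq_prod,
    ← Measure.prod_restrict, Measure.restrict_univ, integral_prod _ hp, ← integral_const_mul]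
  congr 1
  ext t
  rw [integral_fun_norm_addHaar volume (fun s : ℝ => G √(t ^ 2 + s ^ 2) * Real.cos (t * R)),
    finrank_euclideanSpace_fin, nsmul_eq_mul, smul_eq_mul, mul_assoc]
  simp only [smul_eq_mul, mul_assoc]

/-- The planar integral of a radial function in polar coordinates. -/
lemma planar_integral_eq (hn : 0 < n) (hi : IntegrableOn (fun ρ => ρ ^ n * G ρ) (Set.Ioi 0)) (R : ℝ) :
    ∫ q in Set.univ ×ˢ Set.Ioi (0 : ℝ),
        q.2 ^ (n - 1) * G √(q.1 ^ 2 + q.2 ^ 2) * Real.cos (q.1 * R) =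
      ∫ ρ in Set.Ioi (0 : ℝ), G ρ * ρ ^ n * poissonIntegral (n - 1) (ρ * R) := by
  have hS : MeasurableSet (Set.univ ×ˢ Set.Ioi (0 : ℝ) : Set (ℝ × ℝ)) :=
    MeasurableSet.univ.prod measurableSet_Ioi
  rw [← integral_indicator hS, ← integral_comp_polarCoord_symm]
  -- The polar chart has angles in `(-π, π)`; the upper half-plane takes up `(0, π)`. The Jacobian
  -- `ρ` and `(ρ sin θ)^{n-1}` combine to `ρ^n sin^{n-1} θ`.
  have hsub : (Set.Ioi (0 : ℝ) ×ˢ Set.Ioo 0 Real.pi : Set (ℝ × ℝ)) ⊆ polarCoord.target := by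
    rw [polarCoord_target]
    exact Set.prod_mono_right (Set.Ioo_subset_Ioo_left (by linarith [Real.pi_pos]))
  rw [setIntegral_eq_of_subset_of_forall_sdiff_eq_zero polarCoord.open_target.measurableSet hsub]
  · have hm : MeasurableSet (Set.Ioi (0 : ℝ) ×ˢ Set.Ioo 0 Real.pi : Set (ℝ × ℝ)) :=
      measurableSet_Ioi.prod measurableSet_Ioo
    have hcongr : Set.EqOn (fun p : ℝ × ℝ => p.1 • (Set.univ ×ˢ Set.Ioi (0 : ℝ)).indicator
          (fun q : ℝ × ℝ => q.2 ^ (n - 1) * G √(q.1 ^ 2 + q.2 ^ 2) * Real.cos (q.1 * R))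
          (polarCoord.symm p))
        (fun p => p.1 ^ n * G p.1 * (Real.sin p.2 ^ (n - 1) * Real.cos (p.1 * R * Real.cos p.2)))
        (Set.Ioi (0 : ℝ) ×ˢ Set.Ioo 0 Real.pi) := by
      rintro ⟨ρ, θ⟩ ⟨hρ, hθ⟩
      simp only [Set.mem_Ioi] at hρ
      have hs := Real.sin_pos_of_mem_Ioo hθ
      have hsq : √((ρ * Real.cos θ) ^ 2 + (ρ * Real.sin θ) ^ 2) = ρ := by
        rw [mul_pow, mul_pow, ← mul_add, Real.cos_sq_add_sin_sq, mul_one, Real.sqrt_sq hρ.le]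
      have hmem : (ρ * Real.cos θ, ρ * Real.sin θ) ∈ Set.univ ×ˢ Set.Ioi (0 : ℝ) :=
        ⟨trivial, mul_pos hρ hs⟩
      obtain ⟨m, rfl⟩ : ∃ m, n = m + 1 := ⟨n - 1, by omega⟩
      simp only [polarCoord_symm_apply, Set.indicator_of_mem hmem, hsq, smul_eq_mul,
        Nat.add_sub_cancel]
      rw [show ρ * R * Real.cos θ = ρ * Real.cos θ * R by ring]
      ring
    rw [setIntegral_congr_fun hm hcongr, Measure.volume_eq_prod, setIntegral_prod]
    · refine setIntegral_congr_fun measurableSet_Ioi fun ρ _ => ?_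
      simp only
      rw [integral_const_mul, poissonIntegral, intervalIntegral.integral_of_le Real.pi_pos.le,
        integral_Ioc_eq_integral_Ioo]
      ring
    · rw [IntegrableOn, ← Measure.prod_restrict]
      have h1 : Integrable (fun _ : ℝ => (1 : ℝ)) (volume.restrict (Set.Ioo 0 Real.pi)) := by
        simp
      have h2 := Integrable.mul_prod hi h1
      simp only [mul_one] at h2
      refine h2.mul_bdd (c := 1) (by fun_prop) (ae_of_all _ fun p => ?_)
      rw [norm_mul, norm_pow, Real.norm_eq_abs, Real.norm_eq_abs]
      exact mul_le_one₀ (pow_le_one₀ (abs_nonneg _) (Real.abs_sin_le_one _)) (abs_nonneg _)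
        (Real.abs_cos_le_one _)
  · rintro ⟨ρ, θ⟩ ⟨hp, hnot⟩
    rw [polarCoord_target] at hp
    have hρ : 0 < ρ := hp.1
    have hθ : θ ≤ 0 := by
      by_contra h
      exact hnot ⟨hp.1, not_le.1 h, hp.2.2⟩
    have hs : Real.sin θ ≤ 0 := Real.sin_nonpos_of_nonpos_of_neg_pi_le hθ (le_of_lt hp.2.1)
    rw [Set.indicator_of_notMem, smul_zero]
    simp only [polarCoord_symm_apply, Set.mem_prod, Set.mem_univ, Set.mem_Ioi, true_and, not_lt]
    exact mul_nonpos_of_nonneg_of_nonpos hρ.le hs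

end Slice

/-- The Fourier transform of a radial function on `ℝ^{2k+1}` is a radial Fourier integral. -/
theorem exists_integral_radial_mul_cos (k : ℕ) :
    ∃ c : ℝ, 0 < c ∧ ∀ G : ℝ → ℝ, Continuous G → Integrable (fun v : E (2 * k + 1) => G ‖v‖) →
      ∀ x : E (2 * k + 1), ∫ v : E (2 * k + 1), G ‖v‖ * Real.cos (inner ℝ v x) =
        c * radialIntegral G k ‖x‖ := by
  cases k with
  | zero => exact ⟨2, two_pos, fun G _ _ x => integral_radial_mul_cos_dim_one G x⟩
  | succ k =>
    have hn : 0 < 2 * (k + 1) := by positivity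
    have hpos : 0 < ((2 * (k + 1) : ℕ) : ℝ) *
        volume.real (Metric.ball (0 : E (2 * (k + 1))) 1) :=
      mul_pos (by exact_mod_cast hn) (ENNReal.toReal_pos
        (Metric.measure_ball_pos _ _ one_pos).ne' measure_ball_lt_top.ne)
    -- The constant is the area of the unit sphere of `ℝ^{2k+2}` (dimension times ball volume) over
    -- the normalization contained in `radialKernel`.
    refine ⟨_, div_pos hpos (radialConst_pos k), fun G hG hi x => ?_⟩
    have hi' := hi
    rw [integrable_fun_norm_addHaar volume, finrank_euclideanSpace_fin] at hi'
    rw [integral_radial_mul_cos_inner_eq, integral_radial_mul_cos_eq_planar hn hG hi,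
      planar_integral_eq hn hi', radialIntegral, div_mul_eq_mul_div, mul_div_assoc,
      ← integral_div]
    congr 2
    ext ρ
    have := (radialConst_pos k).ne'
    rw [radialKernel, show 2 * (k + 1) - 1 = 2 * k + 1 by omega]
    field_simp

/-! ### The inverse Fourier transform on `L¹ ∩ L²` -/

section FourierLp

variable {V : Type*} [NormedAddCommGroup V] [InnerProductSpace ℝ V] [MeasurableSpace V]
  [BorelSpace V] [FiniteDimensional ℝ V]

/-- The multiplication formula for integrable functions, carried from `𝓕` to `𝓕⁻` by the
substitution `ξ ↦ -ξ`. -/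
lemma integral_fourierInv_smul_eq_of_integrable {φ h : V → ℂ} (hφ : Integrable φ)
    (hh : Integrable h) : ∫ ξ, 𝓕⁻ φ ξ • h ξ = ∫ x, φ x • 𝓕⁻ h x := by
  have h1 : ∫ ξ, 𝓕 φ ξ • h (-ξ) = ∫ x, φ x • 𝓕 (fun y => h (-y)) x := by
    simpa using! VectorFourier.integral_fourierIntegral_smul_eq_flip (L := innerₗ V)
      (μ := volume) (ν := volume) Real.continuous_fourierChar continuous_inner hφ hh.comp_neg
  rw [Real.fourierInv_eq_fourier_comp_neg h, ← h1, ← integral_neg_eq_self]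
  simp [Real.fourierInv_eq_fourier_neg]

lemma continuous_fourierInv_of_integrable {h : V → ℂ} (hh : Integrable h) : Continuous (𝓕⁻ h) := by
  rw [Real.fourierInv_eq_fourier_comp_neg h]
  exact VectorFourier.fourierIntegral_continuous Real.continuous_fourierChar
    (by exact continuous_inner) hh.comp_neg

/-- On `L¹ ∩ L²` the inverse Fourier transform of `L²` is the inverse Fourier integral. -/
theorem coeFn_fourierInv_toLp {h : V → ℂ} (h1 : Integrable h) (h2 : MemLp h 2) :
    (𝓕⁻ (h2.toLp h) : Lp ℂ 2 (volume : Measure V)) =ᵐ[volume] 𝓕⁻ h := by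
  refine ae_eq_of_integral_contDiff_smul_eq
    ((Lp.memLp _).locallyIntegrable (by norm_num))
    (continuous_fourierInv_of_integrable h1).locallyIntegrable fun g hg hgc => ?_
  have hgc' : HasCompactSupport (Complex.ofRealCLM ∘ g) := hgc.comp_left rfl
  have hg' : ContDiff ℝ (⊤ : ℕ∞) (Complex.ofRealCLM ∘ g) := by fun_prop
  set φ : SchwartzMap V ℂ := hgc'.toSchwartzMap hg' with hφ
  -- The `L²` transform agrees with that of tempered distributions, so testing it against `φ` moves
  -- the transform onto `φ`, where it is an honest integral.
  have hT := congrArg (fun T : TemperedDistribution V ℂ => T φ)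
    (Lp.fourierInv_toTemperedDistribution_eq (h2.toLp h))
  simp only [TemperedDistribution.fourierInv_apply, Lp.toTemperedDistribution_apply] at hT
  have e1 : ∫ x, (𝓕⁻ φ : SchwartzMap V ℂ) x • (h2.toLp h) x = ∫ x, 𝓕⁻ (φ : V → ℂ) x • h x := by
    refine integral_congr_ae ?_
    filter_upwards [h2.coeFn_toLp] with x hx
    rw [hx, SchwartzMap.fourierInv_coe]
  rw [e1, integral_fourierInv_smul_eq_of_integrable φ.integrable h1] at hT
  have e2 : ∀ x, φ x = (g x : ℂ) := fun x => by simp [hφ]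
  simp only [e2, smul_eq_mul, ← Complex.real_smul] at hT
  exact hT.symm

end FourierLp

/-! ### Reproducing kernels with a feature map -/

section FeatureMap

variable {X : Type*} {L : Type*} [NormedAddCommGroup L] [InnerProductSpace ℝ L]

/-- The operator-valued kernel of a feature map. -/
def featureKernel (V : X → L) : Matrix X X (ℝ →L[ℝ] ℝ) :=
  .of fun x y => (inner ℝ (V x) (V y) : ℝ) • ContinuousLinearMap.id ℝ ℝ

lemma featureKernel_apply (V : X → L) (x y : X) (a : ℝ) :
    featureKernel V x y a = inner ℝ (V x) (V y) * a := by
  simp [featureKernel]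

-- The quadratic form with coefficients `c` is the squared norm of the combination `∑ c x • V x`.
open scoped ComplexOrder in
lemma posSemidef_featureKernel (V : X → L) : (featureKernel V).PosSemidef := by
  have htfae := (RKHS.posSemidef_tfae (K := featureKernel V)).out 0 2
  refine htfae.2 ⟨?_, fun c => ?_⟩
  · ext x y
    refine ext_inner_right ℝ fun a => ?_
    rw [Matrix.conjTranspose_apply, ContinuousLinearMap.star_eq_adjoint,
      ContinuousLinearMap.adjoint_inner_left, featureKernel_apply, featureKernel_apply,
      real_inner_comm (V x) (V y)]
    simp [mul_comm]
  · have e : (c.sum fun x w => c.sum fun x' w' => inner ℝ (featureKernel V x' x w) w') =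
        inner ℝ (c.sum fun x w => w • V x) (c.sum fun x w => w • V x) := by
      rw [Finsupp.sum_inner]
      refine Finsupp.sum_congr fun x _ => ?_
      rw [Finsupp.inner_sum]
      refine Finsupp.sum_congr fun y _ => ?_
      rw [featureKernel_apply, inner_smul_left, inner_smul_right, real_inner_comm (V x) (V y)]
      simp
      ring
    rw [e]
    exact inner_self_nonneg

/-- A kernel with a feature map is the reproducing kernel of a Hilbert space. -/
theorem exists_isReproducingKernel {X : Type} (V : X → L) :
    ∃ (H : Type) (_ : NormedAddCommGroup H) (_ : InnerProductSpace ℝ H) (_ : CompleteSpace H)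
      (_ : RKHS ℝ H X ℝ), IsReproducingKernel H fun x y => inner ℝ (V x) (V y) := by
  have : Fact (featureKernel V).PosSemidef := ⟨posSemidef_featureKernel V⟩
  refine ⟨RKHS.OfKernel (featureKernel V), inferInstance, inferInstance, inferInstance,
    inferInstance, fun y => ⟨RKHS.kerFun _ y 1, fun x => ?_, fun f => ?_⟩⟩
  · rw [RKHS.kerFun_apply, RKHS.OfKernel.kernel_ofKernel, featureKernel_apply, mul_one]
  · simp

/-- A Hilbert space whose reproducing kernel has a feature map embeds isometrically into the
closed span of the features. -/
theorem exists_isometry_of_isReproducingKernel [CompleteSpace L] (V : X → L) {H : Type*}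
    [NormedAddCommGroup H] [InnerProductSpace ℝ H] [CompleteSpace H] [RKHS ℝ H X ℝ]
    (hH : IsReproducingKernel H fun x y => inner ℝ (V x) (V y)) :
    ∃ W : H →L[ℝ] L, (∀ f, ‖W f‖ = ‖f‖) ∧ (∀ f y, f y = inner ℝ (W f) (V y)) ∧
      ∀ z, (∀ x, inner ℝ (V x) z = 0) → ∀ f, inner ℝ (W f) z = 0 := by
  choose κ hκ hκr using hH
  set A : (X →₀ ℝ) →ₗ[ℝ] H := Finsupp.linearCombination ℝ κ with hA
  set B : (X →₀ ℝ) →ₗ[ℝ] L := Finsupp.linearCombination ℝ V with hB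
  have hκκ : ∀ x y, inner ℝ (κ x) (κ y) = inner ℝ (V x) (V y) := fun x y => by
    rw [← hκr y (κ x), hκ, real_inner_comm]
  have hin : ∀ c d, inner ℝ (A c) (A d) = inner ℝ (B c) (B d) := fun c d => by
    simp only [hA, hB, Finsupp.linearCombination_apply, Finsupp.sum_inner, Finsupp.inner_sum,
      inner_smul_left, inner_smul_right, hκκ]
  have hnorm : ∀ c, ‖B c‖ = ‖A c‖ := fun c => by
    rw [← sq_eq_sq₀ (norm_nonneg _) (norm_nonneg _), ← real_inner_self_eq_norm_sq,
      ← real_inner_self_eq_norm_sq, hin]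
  -- By the reproducing property, a function orthogonal to all kernel sections vanishes everywhere.
  have hdense : DenseRange A := by
    have h : (LinearMap.range A).topologicalClosure = ⊤ := by
      rw [Submodule.topologicalClosure_eq_top_iff, Submodule.eq_bot_iff]
      intro f hf
      refine RKHS.ext fun y => ?_
      rw [hκr y f, real_inner_comm, RKHS.coe_zero]
      exact hf _ ⟨Finsupp.single y 1, by simp [hA]⟩
    have h2 := (Submodule.dense_iff_topologicalClosure_eq_top (s := LinearMap.range A)).2 h
    rwa [LinearMap.coe_range] at h2
  -- Since `A c` and `B c` have equal norms, `A c ↦ B c` is well defined even if `A` is not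
  -- injective, and extends by density.
  set W : H →L[ℝ] L := B.extendOfNorm A
  have hW : ∀ c, W (A c) = B c :=
    LinearMap.extendOfNorm_eq hdense ⟨1, fun c => by rw [one_mul, hnorm]⟩
  have hWκ : ∀ x, W (κ x) = V x := fun x => by
    simpa [hA, hB] using hW (Finsupp.single x 1)
  have hWin : ∀ f g, inner ℝ (W f) (W g) = inner ℝ f g := fun f g => by
    refine hdense.induction_on₂ (p := fun f g => inner ℝ (W f) (W g) = inner ℝ f g)
      (isClosed_eq (by fun_prop) (by fun_prop)) (fun c d => ?_) f g
    rw [hW, hW, hin]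
  refine ⟨W, fun f => ?_, fun f y => by rw [hκr, ← hWin, hWκ], fun z hz f => ?_⟩
  · rw [← sq_eq_sq₀ (norm_nonneg _) (norm_nonneg _), ← real_inner_self_eq_norm_sq,
      ← real_inner_self_eq_norm_sq, hWin]
  · refine hdense.induction_on (p := fun f => inner ℝ (W f) z = 0) f
      (isClosed_eq (by fun_prop) (by fun_prop)) fun c => ?_
    rw [hW, hB, Finsupp.linearCombination_apply, Finsupp.sum_inner]
    simp [inner_smul_left, hz]

end FeatureMap

/-! ### Native spaces of functions with a spectral density -/

lemma real_inner_eq_re_mul_conj (z w : ℂ) : inner ℝ z w = (w * (starRingEnd ℂ) z).re := by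
  rw [Complex.inner, mul_comm]

/-- The native space is real, so `L²` is used with its real inner product; pairing with `I * w`
recovers the imaginary part. -/
lemma real_inner_I_mul_eq_neg_im (z w : ℂ) :
    inner ℝ z (Complex.I * w) = -(w * (starRingEnd ℂ) z).im := by
  rw [real_inner_eq_re_mul_conj, mul_assoc, Complex.I_mul_re]

section SpectralFeature

variable {d : ℕ} {p : E d → ℝ}

/-- The feature `ξ ↦ √p(ξ) exp(-2πi⟨ξ, y⟩)` of the point `y`. -/
def spectralFeature (p : E d → ℝ) (y ξ : E d) : ℂ :=
  (√(p ξ) : ℂ) * Complex.exp (((-(2 * Real.pi * inner ℝ ξ y) : ℝ) : ℂ) * Complex.I)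

lemma norm_spectralFeature (y ξ : E d) : ‖spectralFeature p y ξ‖ = √(p ξ) := by
  rw [spectralFeature, norm_mul, Complex.norm_exp_ofReal_mul_I, mul_one, Complex.norm_real,
    Real.norm_of_nonneg (Real.sqrt_nonneg _)]

lemma memLp_sqrt (hc : Continuous p) (h0 : ∀ ξ, 0 ≤ p ξ) (hi : Integrable p) :
    MemLp (fun ξ => (√(p ξ) : ℂ)) 2 volume := by
  rw [memLp_two_iff_integrable_sq_norm (by fun_prop)]
  refine hi.congr (ae_of_all _ fun ξ => ?_)
  simp [Real.sq_sqrt (h0 ξ)]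

lemma memLp_spectralFeature (hc : Continuous p) (h0 : ∀ ξ, 0 ≤ p ξ) (hi : Integrable p) (y : E d) :
    MemLp (spectralFeature p y) 2 volume := by
  refine (memLp_sqrt hc h0 hi).of_le ?_ (ae_of_all _ fun ξ => ?_)
  · unfold spectralFeature
    fun_prop
  · rw [norm_spectralFeature, Complex.norm_real, Real.norm_of_nonneg (Real.sqrt_nonneg _)]

/-- The feature of the point `y` as an element of `L²`. -/
def spectralFeatureLp (hc : Continuous p) (h0 : ∀ ξ, 0 ≤ p ξ) (hi : Integrable p) (y : E d) :
    Lp ℂ 2 (volume : Measure (E d)) :=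
  (memLp_spectralFeature hc h0 hi y).toLp _

lemma conj_mul_spectralFeature (h0 : ∀ ξ, 0 ≤ p ξ) (x y ξ : E d) :
    spectralFeature p y ξ * (starRingEnd ℂ) (spectralFeature p x ξ) =
      ((p ξ * Real.cos (2 * Real.pi * inner ℝ ξ (x - y)) : ℝ) : ℂ) +
        ((p ξ * Real.sin (2 * Real.pi * inner ℝ ξ (x - y)) : ℝ) : ℂ) * Complex.I := by
  have hp : (√(p ξ) : ℂ) * (√(p ξ) : ℂ) = (p ξ : ℂ) := by
    rw [← Complex.ofReal_mul, Real.mul_self_sqrt (h0 ξ)]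
  have he : Complex.exp (((-(2 * Real.pi * inner ℝ ξ y) : ℝ) : ℂ) * Complex.I) *
      Complex.exp (((2 * Real.pi * inner ℝ ξ x : ℝ) : ℂ) * Complex.I) =
      Complex.exp (((2 * Real.pi * inner ℝ ξ (x - y) : ℝ) : ℂ) * Complex.I) := by
    rw [← Complex.exp_add, inner_sub_right]
    congr 1
    push_cast
    ring
  have hconj : (starRingEnd ℂ) (spectralFeature p x ξ) =
      (√(p ξ) : ℂ) * Complex.exp (((2 * Real.pi * inner ℝ ξ x : ℝ) : ℂ) * Complex.I) := by
    rw [spectralFeature, map_mul, Complex.conj_ofReal, ← Complex.exp_conj, map_mul,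
      Complex.conj_ofReal, Complex.conj_I]
    congr 2
    push_cast
    ring
  rw [hconj, spectralFeature, mul_mul_mul_comm, hp, he, Complex.exp_mul_I, ← Complex.ofReal_cos,
    ← Complex.ofReal_sin]
  push_cast
  ring

lemma inner_spectralFeatureLp (hc : Continuous p) (h0 : ∀ ξ, 0 ≤ p ξ) (hi : Integrable p)
    (x y : E d) :
    inner ℝ (spectralFeatureLp hc h0 hi x) (spectralFeatureLp hc h0 hi y) =
      ∫ ξ, p ξ * Real.cos (2 * Real.pi * inner ℝ ξ (x - y)) := by
  rw [L2.inner_def]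
  refine integral_congr_ae ?_
  filter_upwards [(memLp_spectralFeature hc h0 hi x).coeFn_toLp,
    (memLp_spectralFeature hc h0 hi y).coeFn_toLp] with ξ hx hy
  rw [spectralFeatureLp, spectralFeatureLp, hx, hy, real_inner_eq_re_mul_conj,
    conj_mul_spectralFeature h0]
  simp [-Complex.ofReal_mul]

/-- The inner product is a sine integral, zero because `p` is even. It forces the functions
recovered from `W f` to be real-valued. -/
lemma inner_I_smul_spectralFeatureLp (hc : Continuous p) (h0 : ∀ ξ, 0 ≤ p ξ) (hi : Integrable p)
    (he : ∀ ξ, p (-ξ) = p ξ) (x y : E d) :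
    inner ℝ (spectralFeatureLp hc h0 hi x) (Complex.I • spectralFeatureLp hc h0 hi y) = 0 := by
  rw [L2.inner_def, ← neg_eq_zero, ← integral_neg,
    ← integral_mul_sin_inner_eq_zero he (2 * Real.pi) (x - y)]
  refine integral_congr_ae ?_
  filter_upwards [(memLp_spectralFeature hc h0 hi x).coeFn_toLp,
    (memLp_spectralFeature hc h0 hi y).coeFn_toLp,
    Lp.coeFn_smul Complex.I (spectralFeatureLp hc h0 hi y)] with ξ hx hy hs
  rw [hs, Pi.smul_apply, spectralFeatureLp, spectralFeatureLp, hx, hy, smul_eq_mul,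
    real_inner_I_mul_eq_neg_im, conj_mul_spectralFeature h0]
  simp [-Complex.ofReal_mul]

lemma memLp_sqrt_mul (hc : Continuous p) {B : ℝ} (hB : ∀ ξ, p ξ ≤ B)
    (u : Lp ℂ 2 (volume : Measure (E d))) : MemLp (fun ξ => (√(p ξ) : ℂ) * u ξ) 2 volume := by
  have h : Continuous fun ξ => (√(p ξ) : ℂ) := by fun_prop
  refine (Lp.memLp u).of_le_mul (c := √B)
    (h.aestronglyMeasurable.mul (Lp.aestronglyMeasurable u)) (ae_of_all _ fun ξ => ?_)
  rw [norm_mul, Complex.norm_real, Real.norm_of_nonneg (Real.sqrt_nonneg _)]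
  gcongr
  exact hB ξ

/-- Multiplication by `√p` on `L²`, for a bounded continuous `p`. -/
def mulSqrt (hc : Continuous p) {B : ℝ} (hB : ∀ ξ, p ξ ≤ B) :
    Lp ℂ 2 (volume : Measure (E d)) →ₗ[ℝ] Lp ℂ 2 (volume : Measure (E d)) where
  toFun u := (memLp_sqrt_mul hc hB u).toLp _
  map_add' u v := by
    rw [← MemLp.toLp_add]
    refine MemLp.toLp_congr _ _ ?_
    filter_upwards [Lp.coeFn_add u v] with ξ h
    simp only [h, Pi.add_apply, mul_add]
  map_smul' r u := by
    rw [RingHom.id_apply, ← MemLp.toLp_const_smul]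
    refine MemLp.toLp_congr _ _ ?_
    filter_upwards [Lp.coeFn_smul r u] with ξ h
    simp only [h, Pi.smul_apply, mul_smul_comm]

lemma coeFn_mulSqrt (hc : Continuous p) {B : ℝ} (hB : ∀ ξ, p ξ ≤ B)
    (u : Lp ℂ 2 (volume : Measure (E d))) :
    mulSqrt hc hB u =ᵐ[volume] fun ξ => (√(p ξ) : ℂ) * u ξ :=
  (memLp_sqrt_mul hc hB u).coeFn_toLp

lemma integrable_mulSqrt (hc : Continuous p) (h0 : ∀ ξ, 0 ≤ p ξ) (hi : Integrable p) {B : ℝ}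
    (hB : ∀ ξ, p ξ ≤ B) (u : Lp ℂ 2 (volume : Measure (E d))) :
    Integrable (mulSqrt hc hB u) :=
  ((memLp_sqrt hc h0 hi).integrable_mul (Lp.memLp u)).congr (coeFn_mulSqrt hc hB u).symm

/-- The reproducing functional of the features is the inverse Fourier transform of `√p u`. -/
lemma inner_spectralFeatureLp_eq_re_im (hc : Continuous p) (h0 : ∀ ξ, 0 ≤ p ξ) (hi : Integrable p)
    {B : ℝ} (hB : ∀ ξ, p ξ ≤ B) (u : Lp ℂ 2 (volume : Measure (E d))) (y : E d) :
    inner ℝ u (spectralFeatureLp hc h0 hi y) = (𝓕⁻ (mulSqrt hc hB u : E d → ℂ) y).re ∧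
      inner ℝ u (Complex.I • spectralFeatureLp hc h0 hi y) =
        (𝓕⁻ (mulSqrt hc hB u : E d → ℂ) y).im := by
  have hint : Integrable fun ξ =>
      Complex.exp (((2 * Real.pi * inner ℝ ξ y : ℝ) : ℂ) * Complex.I) • mulSqrt hc hB u ξ := by
    refine (integrable_mulSqrt hc h0 hi hB u).bdd_mul (c := 1) (by fun_prop)
      (ae_of_all _ fun ξ => ?_)
    rw [Complex.norm_exp_ofReal_mul_I]
  have hkey : ∀ᵐ ξ : E d, (starRingEnd ℂ) (Complex.exp (((2 * Real.pi * inner ℝ ξ y : ℝ) : ℂ) *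
      Complex.I) • mulSqrt hc hB u ξ) =
        spectralFeatureLp hc h0 hi y ξ * (starRingEnd ℂ) (u ξ) := by
    filter_upwards [(memLp_spectralFeature hc h0 hi y).coeFn_toLp, coeFn_mulSqrt hc hB u]
      with ξ hy hu
    rw [spectralFeatureLp, hy, hu, spectralFeature, smul_eq_mul, map_mul, map_mul,
      Complex.conj_ofReal, ← Complex.exp_conj, map_mul, Complex.conj_ofReal, Complex.conj_I]
    push_cast
    ring_nf
  rw [Real.fourierInv_eq', L2.inner_def, L2.inner_def]
  refine ⟨?_, ?_⟩
  · have h := integral_re hint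
    simp only [RCLike.re_to_complex] at h
    rw [← h]
    refine integral_congr_ae ?_
    filter_upwards [hkey] with ξ hξ
    rw [real_inner_eq_re_mul_conj, ← hξ, Complex.conj_re]
  · have h := integral_im hint
    simp only [RCLike.im_to_complex] at h
    rw [← h]
    refine integral_congr_ae ?_
    filter_upwards [hkey, Lp.coeFn_smul Complex.I (spectralFeatureLp hc h0 hi y)] with ξ hξ hs
    rw [hs, Pi.smul_apply, smul_eq_mul, real_inner_I_mul_eq_neg_im, ← hξ, Complex.conj_im, neg_neg]

end SpectralFeature

/-! ### Sobolev bounds and the native spaces of Wu functions -/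

section Sobolev

variable {d : ℕ}

lemma fourierL2_fourierInv (g : Lp ℂ 2 (volume : Measure (E d))) (ω : E d) :
    fourierL2 (𝓕⁻ g : Lp ℂ 2 (volume : Measure (E d))) ω =
      (((2 * Real.pi) ^ (-(d : ℝ) / 2) : ℝ) : ℂ) * g ((2 * Real.pi)⁻¹ • ω) := by
  rw [fourierL2, FourierTransform.fourier_fourierInv_eq]

/-- The squared unitary prefactor cancels the Jacobian of `ω = 2πξ`, so only the prefactor of
`sobolevInner` survives in the norm bound. -/
lemma sq_two_pi_rpow_mul (d : ℕ) :
    ((2 * Real.pi) ^ (-(d : ℝ) / 2)) ^ 2 * (2 * Real.pi) ^ d = 1 := by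
  have h : 0 < 2 * Real.pi := by positivity
  rw [← Real.rpow_natCast _ 2, ← Real.rpow_mul h.le, ← Real.rpow_natCast _ d, ← Real.rpow_add h]
  convert Real.rpow_zero (2 * Real.pi) using 2
  push_cast
  ring

/-- A weighted bound on the Fourier transform is a bound in the Sobolev space. -/
lemma sobolev_bound {s B : ℝ} (hB : 0 ≤ B) {g u : Lp ℂ 2 (volume : Measure (E d))}
    (hgu : ∀ᵐ ξ : E d, ‖g ξ‖ ^ 2 * (1 + ‖(2 * Real.pi) • ξ‖ ^ 2) ^ s ≤ B * ‖u ξ‖ ^ 2) :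
    (𝓕⁻ g : Lp ℂ 2 (volume : Measure (E d))) ∈ sobolevSpace d s ∧
      sobolevNorm s (𝓕⁻ g : Lp ℂ 2 (volume : Measure (E d))) ≤
        √((2 * Real.pi) ^ (-(d : ℝ) / 2) * B) * ‖u‖ := by
  have hπ : 0 < 2 * Real.pi := by positivity
  set κ : ℝ := (2 * Real.pi) ^ (-(d : ℝ) / 2) with hκ
  have hκ0 : 0 ≤ κ := by positivity
  set Q : E d → ℝ := fun ξ => ‖g ξ‖ ^ 2 * (1 + ‖(2 * Real.pi) • ξ‖ ^ 2) ^ s with hQ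
  have hu2 : Integrable fun ξ => ‖u ξ‖ ^ 2 :=
    (memLp_two_iff_integrable_sq_norm (Lp.aestronglyMeasurable u)).1 (Lp.memLp u)
  have hgm : StronglyMeasurable g := Lp.stronglyMeasurable g
  have hwc (r : ℝ) : Continuous fun ω : E d => (1 + ‖ω‖ ^ 2) ^ r :=
    Continuous.rpow_const (by fun_prop) fun ω => Or.inl (by positivity)
  have hQi : Integrable Q := by
    refine (hu2.const_mul B).mono' ?_ ?_
    · exact (hgm.norm.pow 2).aestronglyMeasurable.mul
        ((hwc s).comp (by fun_prop : Continuous fun ξ : E d => (2 * Real.pi) • ξ)).aestronglyMeasurable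
    · filter_upwards [hgu] with ξ hξ
      rw [Real.norm_of_nonneg (by positivity)]
      exact hξ
  have hN (ω : E d) : Q ((2 * Real.pi)⁻¹ • ω) =
      ‖g ((2 * Real.pi)⁻¹ • ω)‖ ^ 2 * (1 + ‖ω‖ ^ 2) ^ s := by
    simp only [hQ]
    rw [smul_inv_smul₀ hπ.ne']
  have hNi : Integrable fun ω => κ ^ 2 * Q ((2 * Real.pi)⁻¹ • ω) :=
    (hQi.comp_smul (inv_ne_zero hπ.ne')).const_mul _
  have hNint : ∫ ω, κ ^ 2 * Q ((2 * Real.pi)⁻¹ • ω) = ∫ ξ, Q ξ := by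
    rw [integral_const_mul, Measure.integral_comp_smul, finrank_euclideanSpace_fin, smul_eq_mul,
      inv_pow, inv_inv, abs_of_pos (by positivity), ← mul_assoc, hκ, sq_two_pi_rpow_mul, one_mul]
  constructor
  · have hm : AEStronglyMeasurable (fun ω : E d =>
        fourierL2 (𝓕⁻ g : Lp ℂ 2 (volume : Measure (E d))) ω *
          (((1 + ‖ω‖ ^ 2) ^ (s / 2) : ℝ) : ℂ)) volume := by
      simp only [fourierL2_fourierInv]
      refine AEStronglyMeasurable.mul ?_
        (Complex.continuous_ofReal.comp (hwc (s / 2))).aestronglyMeasurable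
      exact ((hgm.comp_measurable (measurable_const_smul _)).const_mul _).aestronglyMeasurable
    refine (memLp_two_iff_integrable_sq_norm hm).2 (hNi.congr (ae_of_all _ fun ω => ?_))
    simp only [hN]
    rw [fourierL2_fourierInv, ← hκ, norm_mul, norm_mul, Complex.norm_real, Complex.norm_real,
      Real.norm_of_nonneg hκ0, Real.norm_of_nonneg (by positivity), mul_pow, mul_pow,
      ← Real.rpow_natCast ((1 + ‖ω‖ ^ 2) ^ (s / 2)), ← Real.rpow_mul (by positivity)]
    push_cast
    rw [div_mul_cancel₀ _ two_ne_zero]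
    ring
  · have hin : sobolevInner s (𝓕⁻ g : Lp ℂ 2 (volume : Measure (E d)))
        (𝓕⁻ g : Lp ℂ 2 (volume : Measure (E d))) = ((κ * ∫ ξ, Q ξ : ℝ) : ℂ) := by
      rw [sobolevInner, ← hκ, Complex.ofReal_mul, ← hNint, ← integral_complex_ofReal]
      congr 2
      ext ω
      rw [Complex.mul_conj, Complex.normSq_eq_norm_sq, fourierL2_fourierInv, ← hκ, norm_mul,
        Complex.norm_real, Real.norm_of_nonneg hκ0, hN]
      push_cast
      ring
    have hle : ∫ ξ, Q ξ ≤ B * ‖u‖ ^ 2 := by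
      have hun : ‖u‖ ^ 2 = ∫ ξ, ‖u ξ‖ ^ 2 := by
        rw [← real_inner_self_eq_norm_sq, L2.inner_def]
        simp only [real_inner_self_eq_norm_sq]
      rw [hun, ← integral_const_mul]
      exact integral_mono_ae hQi (hu2.const_mul B) hgu
    rw [sobolevNorm, hin, Complex.ofReal_re]
    refine Real.sqrt_le_iff.2 ⟨by positivity, ?_⟩
    rw [mul_pow, Real.sq_sqrt (by positivity), mul_assoc]
    gcongr

end Sobolev

section SpectralDensity

variable {d : ℕ} {p Φ : E d → ℝ}

/-- A function with a spectral density has a native space. -/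
theorem exists_isNativeSpace_of_spectralDensity (hc : Continuous p) (h0 : ∀ ξ, 0 ≤ p ξ)
    (hi : Integrable p) (hΦ : ∀ x, Φ x = ∫ ξ, p ξ * Real.cos (2 * Real.pi * inner ℝ ξ x)) :
    ∃ (H : Type) (_ : NormedAddCommGroup H) (_ : InnerProductSpace ℝ H) (_ : CompleteSpace H)
      (_ : RKHS ℝ H (E d) ℝ), IsNativeSpace H Φ := by
  obtain ⟨H, i1, i2, i3, i4, h⟩ := exists_isReproducingKernel (spectralFeatureLp hc h0 hi)
  refine ⟨H, i1, i2, i3, i4, ?_⟩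
  simpa only [IsNativeSpace, hΦ, ← inner_spectralFeatureLp hc h0 hi] using h

/-- The native space of a function whose spectral density has decay of order `2t` embeds
continuously into the Sobolev spaces of order at most `t`. -/
theorem exists_sobolev_embedding_of_spectralDensity (hc : Continuous p) (h0 : ∀ ξ, 0 ≤ p ξ)
    (hi : Integrable p) (he : ∀ ξ, p (-ξ) = p ξ)
    (hΦ : ∀ x, Φ x = ∫ ξ, p ξ * Real.cos (2 * Real.pi * inner ℝ ξ x)) {B t : ℝ} (ht : 0 ≤ t)
    (hB0 : 0 ≤ B) (hB : ∀ ξ, p ξ ≤ B * (1 + ‖(2 * Real.pi) • ξ‖ ^ 2) ^ (-t)) {s : ℝ} (hs : s ≤ t)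
    (H : Type*) [NormedAddCommGroup H] [InnerProductSpace ℝ H] [CompleteSpace H]
    [RKHS ℝ H (E d) ℝ] (hH : IsNativeSpace H Φ) :
    ∃ J : H →ₗ[ℝ] Lp ℂ 2 (volume : Measure (E d)), Function.Injective J ∧ ∀ f : H,
      (∀ᵐ x : E d, J f x = ((f x : ℝ) : ℂ)) ∧ J f ∈ sobolevSpace d s ∧
        sobolevNorm s (J f) ≤ √((2 * Real.pi) ^ (-(d : ℝ) / 2) * B) * ‖f‖ := by
  have hw1 (ξ : E d) : (1 : ℝ) ≤ 1 + ‖(2 * Real.pi) • ξ‖ ^ 2 := by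
    linarith [sq_nonneg ‖(2 * Real.pi) • ξ‖]
  have hpB (ξ : E d) : p ξ ≤ B := (hB ξ).trans (mul_le_of_le_one_right hB0
    (Real.rpow_le_one_of_one_le_of_nonpos (hw1 ξ) (by linarith)))
  have hH' : IsReproducingKernel H fun x y =>
      inner ℝ (spectralFeatureLp hc h0 hi x) (spectralFeatureLp hc h0 hi y) := by
    simpa only [IsNativeSpace, hΦ, ← inner_spectralFeatureLp hc h0 hi] using hH
  obtain ⟨W, hWn, hWe, hWo⟩ := exists_isometry_of_isReproducingKernel _ hH'
  -- The real part is the reproducing formula. The imaginary part vanishes because `I` times a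
  -- feature is orthogonal to all features, hence to the range of `W`.
  have hval (f : H) (y : E d) : 𝓕⁻ (mulSqrt hc hpB (W f) : E d → ℂ) y = ((f y : ℝ) : ℂ) := by
    obtain ⟨hre, him⟩ := inner_spectralFeatureLp_eq_re_im hc h0 hi hpB (W f) y
    apply Complex.ext
    · rw [Complex.ofReal_re, hWe, hre]
    · rw [Complex.ofReal_im, ← him]
      exact hWo _ (fun x => inner_I_smul_spectralFeatureLp hc h0 hi he x y) f
  have hae (f : H) : ∀ᵐ x : E d, (𝓕⁻ (mulSqrt hc hpB (W f)) :
      Lp ℂ 2 (volume : Measure (E d))) x = ((f x : ℝ) : ℂ) := by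
    have h := coeFn_fourierInv_toLp (integrable_mulSqrt hc h0 hi hpB (W f)) (Lp.memLp _)
    rw [Lp.toLp_coeFn] at h
    filter_upwards [h] with x hx
    rw [hx, hval]
  set J : H →ₗ[ℝ] Lp ℂ 2 (volume : Measure (E d)) :=
    (((Lp.fourierTransformₗᵢ (E d) ℂ).symm.toLinearEquiv.toLinearMap.restrictScalars ℝ).comp
      (mulSqrt hc hpB)).comp W.toLinearMap with hJ
  have hJf (f : H) : J f = 𝓕⁻ (mulSqrt hc hpB (W f)) := rfl
  refine ⟨J, ?_, fun f => ⟨by rw [hJf]; exact hae f, ?_⟩⟩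
  · rw [injective_iff_map_eq_zero]
    intro f hf
    have hM : mulSqrt hc hpB (W f) = 0 :=
      (Lp.fourierTransformₗᵢ (E d) ℂ).symm.injective (by rw [map_zero]; exact hf)
    -- Once `√p · W f` vanishes almost everywhere, its inverse Fourier integral, the value `f y`, is
    -- zero at every point `y`.
    refine RKHS.ext fun y => ?_
    have h := hval f y
    rw [Real.fourierInv_eq', integral_eq_zero_of_ae] at h
    · rw [RKHS.coe_zero]
      exact_mod_cast h.symm
    · rw [hM]
      filter_upwards [Lp.coeFn_zero ℂ 2 (volume : Measure (E d))] with ξ hξ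
      rw [hξ]
      simp
  · rw [hJf, ← hWn f]
    refine sobolev_bound hB0 ?_
    filter_upwards [coeFn_mulSqrt hc hpB (W f)] with ξ hξ
    have hpos : 0 < 1 + ‖(2 * Real.pi) • ξ‖ ^ 2 := by linarith [hw1 ξ]
    rw [hξ, norm_mul, Complex.norm_real, Real.norm_of_nonneg (Real.sqrt_nonneg _), mul_pow,
      Real.sq_sqrt (h0 ξ), mul_right_comm]
    refine mul_le_mul_of_nonneg_right ?_ (sq_nonneg _)
    calc p ξ * (1 + ‖(2 * Real.pi) • ξ‖ ^ 2) ^ s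
        ≤ B * (1 + ‖(2 * Real.pi) • ξ‖ ^ 2) ^ (-t) * (1 + ‖(2 * Real.pi) • ξ‖ ^ 2) ^ s := by
          gcongr
          exact hB ξ
      _ = B * (1 + ‖(2 * Real.pi) • ξ‖ ^ 2) ^ (s - t) := by
          rw [mul_assoc, ← Real.rpow_add hpos, neg_add_eq_sub]
      _ ≤ B := mul_le_of_le_one_right hB0
          (Real.rpow_le_one_of_one_le_of_nonpos (hw1 ξ) (by linarith))

end SpectralDensity

/-- The Wu function has an even spectral density with decay of order `2ℓ + 2`. -/
theorem exists_spectralDensity_wuRadial {ℓ : ℝ} {k : ℕ} (hk : (k : ℝ) ≤ ℓ) :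
    ∃ (p : E (2 * k + 1) → ℝ) (B : ℝ), Continuous p ∧ (∀ ξ, 0 ≤ p ξ) ∧ Integrable p ∧
      (∀ ξ, p (-ξ) = p ξ) ∧ 0 ≤ B ∧
      (∀ ξ, p ξ ≤ B * (1 + ‖(2 * Real.pi) • ξ‖ ^ 2) ^ (-(ℓ + 1))) ∧
      ∀ x, wuRadial ℓ k x = ∫ ξ, p ξ * Real.cos (2 * Real.pi * inner ℝ ξ x) := by
  have hℓ : 0 ≤ ℓ := k.cast_nonneg.trans hk
  have hπ : 0 < 2 * Real.pi := by positivity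
  have hcont := continuous_powCos hℓ
  obtain ⟨c, hc, hcG⟩ := exists_integral_radial_mul_cos k
  obtain ⟨C, hC, hCle⟩ := exists_sq_powCos_le hℓ
  set G : ℝ → ℝ := fun ω => 4 / Real.pi * powCos ℓ ω ^ 2 with hG
  have hGi : Integrable fun v : E (2 * k + 1) => G ‖v‖ :=
    (integrable_sq_powCos_norm volume hℓ (by
      rw [finrank_euclideanSpace_fin]; push_cast; linarith)).const_mul _
  -- Here `c⁻¹` removes the constant relating the Fourier integral to `radialIntegral`, and the
  -- power of `2π` undoes the dilation to frequencies `2πξ`.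
  set A : ℝ := c⁻¹ * (2 * Real.pi) ^ (2 * k + 1) with hA
  have hA0 : 0 < A := by positivity
  refine ⟨fun ξ => A * G ‖(2 * Real.pi) • ξ‖, A * (4 / Real.pi * C), by fun_prop,
    fun ξ => by positivity, (hGi.comp_smul hπ.ne').const_mul A, fun ξ => by simp, by positivity,
    fun ξ => ?_, fun x => ?_⟩
  · rw [mul_assoc, mul_assoc (4 / Real.pi)]
    exact mul_le_mul_of_nonneg_left (mul_le_mul_of_nonneg_left (hCle _) (by positivity)) hA0.le
  · have h := Measure.integral_comp_smul volume
      (fun v : E (2 * k + 1) => G ‖v‖ * Real.cos (inner ℝ v x)) (2 * Real.pi)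
    rw [hcG G (by fun_prop) hGi x, finrank_euclideanSpace_fin, smul_eq_mul,
      abs_of_pos (by positivity)] at h
    simp only [real_inner_smul_left] at h
    simp only [mul_assoc A]
    rw [integral_const_mul, h, wuRadial, wu_eq_radialIntegral hk, ← hG, hA]
    field_simp

end WuFunctions

end

theorem theorem3p5 (k : ℕ) (ℓ : ℝ) (hkℓ : (k : ℝ) ≤ ℓ) :
    -- the native space exists
    (∃ (H : Type) (_ : NormedAddCommGroup H) (_ : InnerProductSpace ℝ H) (_ : CompleteSpace H)
      (_ : RKHS ℝ H (WuFunctions.E (2 * k + 1)) ℝ),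
      WuFunctions.IsNativeSpace H (WuFunctions.wuRadial ℓ k)) ∧
    -- and it is a linear subspace of the Sobolev space, with continuous inclusion
    ∀ s : ℝ, (k : ℝ) + 1 / 2 < s → s ≤ ℓ + 1 →
      ∃ C : ℝ, ∀ (H : Type*) [NormedAddCommGroup H] [InnerProductSpace ℝ H] [CompleteSpace H]
        [RKHS ℝ H (WuFunctions.E (2 * k + 1)) ℝ],
        WuFunctions.IsNativeSpace H (WuFunctions.wuRadial ℓ k) →
        ∃ J : H →ₗ[ℝ] Lp ℂ 2 (volume : Measure (WuFunctions.E (2 * k + 1))),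
          Function.Injective J ∧
          ∀ f : H,
            (∀ᵐ x : WuFunctions.E (2 * k + 1), J f x = ((f x : ℝ) : ℂ)) ∧
            J f ∈ WuFunctions.sobolevSpace (2 * k + 1) s ∧
            WuFunctions.sobolevNorm s (J f) ≤ C * ‖f‖ := by

  obtain ⟨p, B, hc, h0, hi, he, hB0, hB, hΦ⟩ := WuFunctions.exists_spectralDensity_wuRadial hkℓ
  have hℓ : 0 ≤ ℓ := k.cast_nonneg.trans hkℓ
  -- The constant is `√((2π)^(-d/2) B)` with `d = 2k+1`; as `B` is chosen before `s` and `H`, it is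
  -- the same for all of them.
  exact ⟨WuFunctions.exists_isNativeSpace_of_spectralDensity hc h0 hi hΦ, fun s _ hs =>
    ⟨_, fun H _ _ _ _ hH => WuFunctions.exists_sobolev_embedding_of_spectralDensity hc h0 hi he hΦ
      (by linarith) hB0 hB hs H hH⟩⟩
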